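/- Let $q\ge 2$ be an integer. All graphs are finite, connected, undirected and $(q+1)$-regular; multiple edges and loops are allowed. For a graph $X$ with $n$ vertices let $A f(x)=\frac{1}{q+1}\sum_{y\sim x} f(y)$ be its normalized adjacency operator (the sum taken over the edges at $x$, with multiplicity), let $\lambda_0=1\ge\lambda_1\ge\dots\ge\lambda_{n-1}\ge -1$ be the eigenvalues of $A$ with multiplicity, let $\delta_{x_0}$ be the indicator function of the vertex $x_0$, let $\pi\equiv\frac1n$, and let $\|f\|_1=\sum_x|f(x)|$. The $p$-value of $\lambda_i$ is $p_i=2$ if $|\lambda_i|\le\frac{2\sqrt q}{q+1}$, and otherwise it is the $p_i\in(2,\infty]$ with $|\lambda_i|=\frac{1}{q+1}\left(q^{1/p_i}+q^{1-1/p_i}\right)$, where $1/\infty=0$. A family $\mathcal F$ of such graphs consists of expanders if there is $b<1$ such that every eigenvalue $\lambda_i\ne\pm1$ of every $X\in\mathcal F$ satisfies $|\lambda_i|\le b$. It has the Sarnak--Xue density property if for every $\epsilon>0$ there is a constant $C$ (depending only on $q$, $\mathcal F$ and $\epsilon$) such that $\#\{i: p_i\ge p\}\le C\,n^{2/p+\epsilon}$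 for every $X\in\mathcal F$ and every real $p>2$. Let $\epsilon>0$. (1) For every non-bipartite $X$, every vertex $x_0$ and every integer $k\ge0$ with $k<(1-\epsilon)\frac{q+1}{q-1}\log_q n$, $$\|A^k\delta_{x_0}-\pi\|_1=2-o(1)\qquad(n\to\infty),$$ where the $o(1)$ is bounded in terms of $n$, $q$ and $\epsilon$ only. (2) Let $\mathcal F$ be a family of expanders with the Sarnak--Xue density property. Then one can choose in every $X\in\mathcal F$ a set $B_X$ of vertices such that, for the non-bipartite $X\in\mathcal F$ and $n\to\infty$, $|B_X|=o(n)$ and $$\|A^k\delta_{x_0}-\pi\|_1=o(1)\quad\text{for all } x_0\notin B_X \text{ and all integers } k>(1+\epsilon)\tfrac{q+1}{q-1}\log_q n,$$ where the $o(n)$ and the $o(1)$ depend only on $q$, $\epsilon$ and $\mathcal F$ (uniformly in $X$, $x_0$ and $k$). For the non-bipartite $X\in\mathcal F$ that are moreover vertex-transitive, the last bound holds for every vertex $x_0$ and all such $k$. -/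

import Mathlib

open scoped ENNReal Matrix

universe u v

/-- A finite undirected `(q + 1)`-regular graph on the vertex set `V`, multiple edges and loops
allowed: `mult x y` is the number of edges along which one can step from `x` to `y`, so that
`mult x x` is the contribution of the loops at `x` to the degree of `x`. -/
structure RegularMultigraph (V : Type u) [Fintype V] (q : ℕ) where
  mult : V → V → ℕ
  mult_symm : ∀ x y, mult x y = mult y x
  regular : ∀ x, ∑ y, mult x y = q + 1

namespace RegularMultigraph

variable {V : Type u} [Fintype V] {q : ℕ}

/-- The simple graph that remains when loops are deleted and parallel edges are identified. -/
def toSimpleGraph (X : RegularMultigraph V q) : SimpleGraph V where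
  Adj x y := x ≠ y ∧ X.mult x y ≠ 0
  symm := ⟨fun x y h => ⟨h.1.symm, by rw [X.mult_symm y x]; exact h.2⟩⟩
  loopless := ⟨fun _ h => h.1 rfl⟩

/-- `X` is connected (in particular it has a vertex). -/
def IsConnected (X : RegularMultigraph V q) : Prop :=
  X.toSimpleGraph.Connected

/-- The vertices have a 2-colouring for which every edge joins vertices of different colours
(so a graph with a loop is not bipartite). -/
def IsBipartite (X : RegularMultigraph V q) : Prop :=
  ∃ c : V → Bool, ∀ x y, X.mult x y ≠ 0 → c x ≠ c y

/-- The automorphism group acts transitively on the vertices. -/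
def IsVertexTransitive (X : RegularMultigraph V q) : Prop :=
  ∀ x y, ∃ g : Equiv.Perm V, (∀ a b, X.mult (g a) (g b) = X.mult a b) ∧ g x = y

/-- The normalized adjacency operator `(A f)(x) = (q + 1)⁻¹ * ∑_{y ∼ x} f y`, as a matrix. -/
noncomputable def adjOp (X : RegularMultigraph V q) : Matrix V V ℝ :=
  Matrix.of fun x y => (X.mult x y : ℝ) / ((q : ℝ) + 1)

theorem adjOp_isHermitian (X : RegularMultigraph V q) : X.adjOp.IsHermitian := by
  ext x y
  simp [adjOp, X.mult_symm x y]

/-- The eigenvalues `λ₀ ≥ λ₁ ≥ ⋯ ≥ λₙ₋₁` of `A`, listed with multiplicity. -/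
noncomputable def eigenvalue [DecidableEq V] (X : RegularMultigraph V q) :
    Fin (Fintype.card V) → ℝ :=
  X.adjOp_isHermitian.eigenvalues₀

/-- The `L¹`-distance `‖A ^ k δ_{x₀} - π‖₁` between the law of the simple random walk started at
`x₀` after `k` steps and the uniform probability `π`. -/
noncomputable def distToUniform [DecidableEq V] (X : RegularMultigraph V q) (k : ℕ) (x₀ : V) : ℝ :=
  ∑ x, |((X.adjOp ^ k) *ᵥ (Pi.single x₀ 1)) x - 1 / (Fintype.card V : ℝ)|

end RegularMultigraph

/-- `p ∈ [2, ∞]` is the `p`-value of `lam`: `p = 2` if `|lam| ≤ 2 √q / (q + 1)`, and otherwise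
`2 < p ≤ ∞` with `|lam| = (q ^ (1 / p) + q ^ (1 - 1 / p)) / (q + 1)`, where `1 / ∞ = 0`. -/
def IsPValue (q : ℕ) (lam : ℝ) (p : ℝ≥0∞) : Prop :=
  (|lam| ≤ 2 / ((q : ℝ) + 1) * √(q : ℝ) ∧ p = 2) ∨
  (2 / ((q : ℝ) + 1) * √(q : ℝ) < |lam| ∧ 2 < p ∧
    |lam| = 1 / ((q : ℝ) + 1) * ((q : ℝ) ^ (p⁻¹).toReal + (q : ℝ) ^ (1 - (p⁻¹).toReal)))

/-- The members of the family are (uniform) expanders: all eigenvalues other than `1` and `-1` are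
bounded in absolute value by a constant smaller than `1`. -/
def IsExpanderFamily {ι : Type v} {V : ι → Type u} [∀ i, Fintype (V i)] [∀ i, DecidableEq (V i)]
    {q : ℕ} (X : ∀ i, RegularMultigraph (V i) q) : Prop :=
  ∃ b : ℝ, b < 1 ∧ ∀ i j, (X i).eigenvalue j ≠ 1 → (X i).eigenvalue j ≠ -1 →
    |(X i).eigenvalue j| ≤ b

/-- The Sarnak-Xue density property of a family of graphs: for every `ε > 0` there is a constant
`C` such that `#{j : p_j ≥ p} ≤ C * n ^ (2 / p + ε)` for all members of the family and all
`p > 2`. -/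
def SarnakXueDensity {ι : Type v} {V : ι → Type u} [∀ i, Fintype (V i)] [∀ i, DecidableEq (V i)]
    {q : ℕ} (X : ∀ i, RegularMultigraph (V i) q) : Prop :=
  ∀ ε : ℝ, 0 < ε → ∃ C : ℝ, ∀ i, ∀ p : ℝ, 2 < p →
    ({j | ∃ r, IsPValue q ((X i).eigenvalue j) r ∧ ENNReal.ofReal p ≤ r}.ncard : ℝ) ≤
      C * (Fintype.card (V i) : ℝ) ^ (2 / p + ε)

/-!
The simple random walk on a `(q + 1)`-regular graph moves away from its starting point at speed at
most `(q - 1) / (q + 1)`, the speed on the `(q + 1)`-regular tree, and a ball of radius `r` has at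
most `4 q ^ r` vertices.

*Lower bound.* Let `d` be the distance to the starting point. The function `s ^ d` grows in one
step by at most the factor `(q s + 1 / s) / (q + 1)` on average, up to an additive term for the
returns to the starting point, so that Markov's inequality
(`IsConnected.sum_compl_ball_adjOp_pow_le`) confines the walk before the critical time to a ball
of radius `(1 - ε / 2) log_q n`, which holds `o(n)` vertices.

*Upper bound.* Let `S_j` be the transition operator of `j` steps of the non-backtracking walk,
given by `S_{j+2} = ((q + 1) A S_{j+1} - S_j) / q` (`nbSeq`). These matrices are nonnegative with
column sums `1`, since they come from a flow on oriented edges. The relation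
`A S_{j+1} = (q S_{j+2} + S_j) / (q + 1)` makes `A ^ k` a mixture of the `S_j` in which `j` is
distributed as the position of a walk on `ℕ` with speed `(q - 1) / (q + 1)`. After the critical
time the lengths `j ≤ (1 + ε / 2) log_q n` have negligible weight, where the trivial bound `2`
for the `L¹`-distance suffices (`l1Dist_adjOp_pow_mul_nbSeq_le`). For longer `j`, the average over
the starting points of the squared `L²`-distance is a trace: `∑ s_j(λ) ^ 2` over the eigenvalues
`λ ≠ ± 1`, with `|s_j(λ)| ≤ (3 j + 1) q ^ (-j / p)` where `p` is the `p`-value of `λ`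
(`abs_nbSeq_le`). By the density property the contribution of the eigenvalues with `p`-value about
`p` is at most `n ^ (2 / p + δ - (2 + ε) / p)` up to powers of `log n`, and expansion bounds `p`
from above, so that the whole sum is at most a negative power of `n`
(`exists_sum_nbSeq_sq_le`). Markov's inequality then gives the small exceptional set of starting
points, and on a vertex-transitive graph one good starting point suffices.
-/

/-! ### The random walk as a Markov matrix -/

namespace RegularMultigraph

variable {V : Type u} [Fintype V] {q : ℕ}

theorem adjOp_apply (X : RegularMultigraph V q) (x y : V) :
    X.adjOp x y = (X.mult x y : ℝ) / ((q : ℝ) + 1) := rfl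

theorem adjOp_nonneg (X : RegularMultigraph V q) (x y : V) : 0 ≤ X.adjOp x y := by
  rw [adjOp_apply]; positivity

theorem adjOp_comm (X : RegularMultigraph V q) (x y : V) : X.adjOp x y = X.adjOp y x := by
  rw [adjOp_apply, adjOp_apply, X.mult_symm]

theorem sum_mult_left (X : RegularMultigraph V q) (y : V) :
    ∑ x, (X.mult x y : ℝ) = (q : ℝ) + 1 := by
  have h := X.regular y
  simp_rw [X.mult_symm y] at h
  exact_mod_cast h

theorem sum_adjOp (X : RegularMultigraph V q) (y : V) : ∑ x, X.adjOp x y = 1 := by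
  simp_rw [adjOp_apply]
  rw [← Finset.sum_div, sum_mult_left, div_self (by positivity)]

theorem sum_adjOp_mul_apply (X : RegularMultigraph V q) (M : Matrix V V ℝ) (x₀ : V) :
    ∑ x, (X.adjOp * M) x x₀ = ∑ x, M x x₀ := by
  simp_rw [Matrix.mul_apply]
  rw [Finset.sum_comm]
  refine Finset.sum_congr rfl fun y _ => ?_
  rw [← Finset.sum_mul, sum_adjOp, one_mul]

theorem adjOp_mul_sub_const (X : RegularMultigraph V q) (M : Matrix V V ℝ) (x x₀ : V) (t : ℝ) :
    (X.adjOp * M) x x₀ - t = ∑ y, X.adjOp x y * (M y x₀ - t) := by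
  have h : ∑ y, X.adjOp x y = 1 := by
    simp_rw [X.adjOp_comm x]; exact X.sum_adjOp x
  simp_rw [mul_sub, Finset.sum_sub_distrib, ← Finset.sum_mul, h, one_mul, Matrix.mul_apply]

/-- The `L¹`-distance between the column of index `x₀` of a matrix and the uniform probability. -/
noncomputable def l1Dist (M : Matrix V V ℝ) (x₀ : V) : ℝ :=
  ∑ x, |M x x₀ - 1 / (Fintype.card V : ℝ)|

theorem distToUniform_eq_l1Dist [DecidableEq V] (X : RegularMultigraph V q) (k : ℕ) (x₀ : V) :
    X.distToUniform k x₀ = l1Dist (X.adjOp ^ k) x₀ := by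
  simp [distToUniform, l1Dist]

theorem l1Dist_adjOp_mul_le (X : RegularMultigraph V q) (M : Matrix V V ℝ) (x₀ : V) :
    l1Dist (X.adjOp * M) x₀ ≤ l1Dist M x₀ := by
  unfold l1Dist
  calc ∑ x, |(X.adjOp * M) x x₀ - 1 / (Fintype.card V : ℝ)|
      ≤ ∑ x, ∑ y, X.adjOp x y * |M y x₀ - 1 / (Fintype.card V : ℝ)| := by
        refine Finset.sum_le_sum fun x _ => ?_
        rw [adjOp_mul_sub_const]
        refine (Finset.abs_sum_le_sum_abs _ _).trans (le_of_eq ?_)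
        exact Finset.sum_congr rfl fun y _ => by rw [abs_mul, abs_of_nonneg (X.adjOp_nonneg x y)]
    _ = ∑ y, |M y x₀ - 1 / (Fintype.card V : ℝ)| := by
        rw [Finset.sum_comm]
        refine Finset.sum_congr rfl fun y _ => ?_
        rw [← Finset.sum_mul, sum_adjOp, one_mul]

theorem distToUniform_antitone [DecidableEq V] (X : RegularMultigraph V q) (x₀ : V) :
    Antitone fun k => X.distToUniform k x₀ := by
  refine antitone_nat_of_succ_le fun k => ?_
  simp only [distToUniform_eq_l1Dist, pow_succ']
  exact X.l1Dist_adjOp_mul_le _ _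

theorem l1Dist_le_two [Nonempty V] {M : Matrix V V ℝ} {x₀ : V} (h0 : ∀ x, 0 ≤ M x x₀)
    (h1 : ∑ x, M x x₀ = 1) : l1Dist M x₀ ≤ 2 := by
  have hn : (Fintype.card V : ℝ) ≠ 0 := by exact_mod_cast Fintype.card_ne_zero
  calc l1Dist M x₀ ≤ ∑ x, (M x x₀ + 1 / (Fintype.card V : ℝ)) := by
        refine Finset.sum_le_sum fun x _ => ?_
        have := h0 x
        have h2 : (0 : ℝ) ≤ 1 / (Fintype.card V : ℝ) := by positivity
        rw [abs_le]; constructor <;> linarith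
    _ = 2 := by
        rw [Finset.sum_add_distrib, h1]
        simp [hn]; norm_num

/-- A probability that gives mass at least `1 - t` to a set `B` has distance at least
`2 (1 - t - |B| / n)` from the uniform one. -/
theorem le_l1Dist [DecidableEq V] [Nonempty V] {M : Matrix V V ℝ} {x₀ : V}
    (h1 : ∑ x, M x x₀ = 1) (B : Finset V) {t : ℝ} (ht : ∑ x ∈ Bᶜ, M x x₀ ≤ t) :
    2 - 2 * t - 2 * (B.card / (Fintype.card V : ℝ)) ≤ l1Dist M x₀ := by
  have hn : (Fintype.card V : ℝ) ≠ 0 := by exact_mod_cast Fintype.card_ne_zero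
  have hB : ∑ x ∈ B, (M x x₀ - 1 / (Fintype.card V : ℝ)) ≤
      ∑ x ∈ B, |M x x₀ - 1 / (Fintype.card V : ℝ)| :=
    Finset.sum_le_sum fun x _ => le_abs_self _
  have hBc : ∑ x ∈ Bᶜ, -(M x x₀ - 1 / (Fintype.card V : ℝ)) ≤
      ∑ x ∈ Bᶜ, |M x x₀ - 1 / (Fintype.card V : ℝ)| :=
    Finset.sum_le_sum fun x _ => neg_le_abs _
  have hs := Finset.sum_add_sum_compl B fun x => M x x₀
  have hd : l1Dist M x₀ = _ :=
    (Finset.sum_add_sum_compl B fun x => |M x x₀ - 1 / (Fintype.card V : ℝ)|).symm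
  have hc : ((Bᶜ.card : ℕ) : ℝ) = Fintype.card V - B.card := by
    rw [Finset.card_compl, Nat.cast_sub (Finset.card_le_univ B)]
  rw [hd]
  simp only [Finset.sum_neg_distrib, Finset.sum_sub_distrib, Finset.sum_const, nsmul_eq_mul,
    hc] at hB hBc
  have h3 : ((Fintype.card V : ℝ) - B.card) * (1 / (Fintype.card V : ℝ)) =
      1 - B.card / (Fintype.card V : ℝ) := by field_simp
  have h4 : (B.card : ℝ) * (1 / (Fintype.card V : ℝ)) = B.card / (Fintype.card V : ℝ) := by ring
  rw [h3] at hBc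
  rw [h4] at hB
  linarith

theorem sum_adjOp_pow [DecidableEq V] (X : RegularMultigraph V q) (k : ℕ) (x₀ : V) :
    ∑ x, (X.adjOp ^ k) x x₀ = 1 := by
  induction k with
  | zero => simp [Matrix.one_apply]
  | succ k ih => rw [pow_succ', sum_adjOp_mul_apply, ih]

theorem adjOp_pow_nonneg [DecidableEq V] (X : RegularMultigraph V q) (k : ℕ) (x x₀ : V) :
    0 ≤ (X.adjOp ^ k) x x₀ := by
  induction k generalizing x with
  | zero => simp only [pow_zero, Matrix.one_apply]; split_ifs <;> norm_num
  | succ k ih =>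
    rw [pow_succ', Matrix.mul_apply]
    exact Finset.sum_nonneg fun y _ => mul_nonneg (X.adjOp_nonneg _ _) (ih y)

theorem IsVertexTransitive.distToUniform_eq [DecidableEq V] {X : RegularMultigraph V q}
    (hX : X.IsVertexTransitive) (k : ℕ) (x y : V) :
    X.distToUniform k x = X.distToUniform k y := by
  obtain ⟨g, hg, rfl⟩ := hX x y
  have hA : ∀ a b, (X.adjOp ^ k) (g a) (g b) = (X.adjOp ^ k) a b := by
    induction k with
    | zero => intro a b; simp [Matrix.one_apply]
    | succ k ih =>
      intro a b
      rw [pow_succ', Matrix.mul_apply, Matrix.mul_apply, ← Equiv.sum_comp g]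
      refine Finset.sum_congr rfl fun c _ => ?_
      rw [ih, adjOp_apply, adjOp_apply, hg]
  rw [distToUniform_eq_l1Dist, distToUniform_eq_l1Dist, l1Dist, l1Dist]
  conv_rhs => rw [← Equiv.sum_comp g]
  exact Finset.sum_congr rfl fun c _ => by rw [hA]

end RegularMultigraph

/-! ### The non-backtracking recursion -/

/-- The sequence `1, a, ((q + 1) a² - 1) / q, …` with
`sⱼ₊₂ = ((q + 1) a sⱼ₊₁ - sⱼ) / q`. For `a` the normalized adjacency operator of a
`(q + 1)`-regular graph, `sⱼ` is the transition operator of `j` steps of the non-backtracking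
random walk; for `a` an eigenvalue it is the corresponding eigenvalue of that operator. -/
noncomputable def nbSeq (q : ℕ) {R : Type*} [Ring R] [Algebra ℝ R] (a : R) : ℕ → R
  | 0 => 1
  | 1 => a
  | j + 2 => (1 / (q : ℝ)) • (((q : ℝ) + 1) • (a * nbSeq q a (j + 1)) - nbSeq q a j)

theorem map_nbSeq (q : ℕ) {R S : Type*} [Ring R] [Algebra ℝ R] [Ring S] [Algebra ℝ S]
    (φ : R →ₐ[ℝ] S) (a : R) (j : ℕ) : φ (nbSeq q a j) = nbSeq q (φ a) j := by
  induction j using Nat.twoStepInduction with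
  | zero => simp [nbSeq]
  | one => simp [nbSeq]
  | more j h0 h1 => simp [nbSeq, map_smul, h0, h1]

theorem mul_nbSeq_succ {q : ℕ} (hq : q ≠ 0) {R : Type*} [Ring R] [Algebra ℝ R] (a : R) (j : ℕ) :
    a * nbSeq q a (j + 1) =
      ((q : ℝ) / (q + 1)) • nbSeq q a (j + 2) + (1 / ((q : ℝ) + 1)) • nbSeq q a j := by
  have h1 : (q : ℝ) ≠ 0 := by exact_mod_cast hq
  have h2 : (q : ℝ) + 1 ≠ 0 := by positivity
  rw [nbSeq, smul_smul, smul_sub, smul_smul, sub_add_eq_add_sub, add_sub_assoc, ← sub_smul]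
  have e1 : (q : ℝ) / (q + 1) * (1 / q) * (q + 1) = 1 := by field_simp
  have e2 : 1 / ((q : ℝ) + 1) - (q : ℝ) / (q + 1) * (1 / q) = 0 := by field_simp; ring
  rw [e1, e2, one_smul, zero_smul, add_zero]

namespace RegularMultigraph

variable {V : Type u} [Fintype V] [DecidableEq V] {q : ℕ}

/-- The transition matrices of the non-backtracking walk come from a flow on oriented edges:
`f y x` is the probability that the last step is made along a given edge from `y` to `x`. The
edges with equal endpoints carry the same flow, which is why a function of `y` and `x` suffices. -/
theorem exists_nonbacktracking_flow (hq : q ≠ 0) (X : RegularMultigraph V q) (x₀ : V) (j : ℕ) :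
    ∃ f : V → V → ℝ, (∀ y x, X.mult y x ≠ 0 → 0 ≤ f y x) ∧
      (∀ x, ∑ y, X.mult x y * f x y = nbSeq q X.adjOp j x x₀) ∧
      (∀ x, ∑ y, X.mult y x * f y x = nbSeq q X.adjOp (j + 1) x x₀) := by
  have hq0 : (0 : ℝ) < q := by exact_mod_cast Nat.pos_of_ne_zero hq
  have hdeg : ∀ x, ∑ y, (X.mult x y : ℝ) = q + 1 := fun x => by exact_mod_cast X.regular x
  induction j with
  | zero =>
    refine ⟨fun y _ => if y = x₀ then 1 / ((q : ℝ) + 1) else 0, ?_, ?_, ?_⟩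
    · intro y x _; dsimp only; split_ifs <;> positivity
    · intro x
      rw [← Finset.sum_mul, hdeg]
      simp only [nbSeq, Matrix.one_apply]
      split_ifs
      · field_simp
      · simp
    · intro x
      simp [nbSeq, adjOp_apply, X.mult_symm x x₀, div_eq_mul_inv]
  | succ j ih =>
    obtain ⟨f, hf, hout, hin⟩ := ih
    -- Step along an edge out of `y` other than the reverse of the last one.
    refine ⟨fun y x => (nbSeq q X.adjOp (j + 1) y x₀ - f x y) / q, ?_, ?_, ?_⟩
    · intro y x hyx
      rw [X.mult_symm] at hyx
      refine div_nonneg (sub_nonneg.2 ?_) hq0.le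
      rw [← hin]
      have h1 : (1 : ℝ) ≤ X.mult x y := by exact_mod_cast Nat.one_le_iff_ne_zero.2 hyx
      refine le_trans (le_mul_of_one_le_left (hf x y hyx) h1) ?_
      refine Finset.single_le_sum (f := fun z => (X.mult z y : ℝ) * f z y) (fun z _ => ?_)
        (Finset.mem_univ x)
      by_cases hz : X.mult z y = 0
      · simp [hz]
      · exact mul_nonneg (Nat.cast_nonneg _) (hf z y hz)
    · intro x
      simp_rw [mul_div_assoc', mul_sub]
      rw [← Finset.sum_div, Finset.sum_sub_distrib, ← Finset.sum_mul, hdeg]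
      simp_rw [X.mult_symm x]
      rw [hin]
      field_simp; ring
    · intro x
      simp_rw [mul_div_assoc', mul_sub]
      rw [← Finset.sum_div, Finset.sum_sub_distrib]
      simp_rw [X.mult_symm _ x]
      rw [hout]
      simp only [nbSeq, Matrix.smul_apply, Matrix.sub_apply, Matrix.mul_apply, smul_eq_mul,
        adjOp_apply, Finset.mul_sum]
      have : ∀ y, ((q : ℝ) + 1) * ((X.mult x y : ℝ) / (q + 1) * nbSeq q X.adjOp (j + 1) y x₀) =
          X.mult x y * nbSeq q X.adjOp (j + 1) y x₀ := fun y => by field_simp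
      simp_rw [this]
      ring

theorem nbSeq_adjOp_nonneg (hq : q ≠ 0) (X : RegularMultigraph V q) (j : ℕ) (x x₀ : V) :
    0 ≤ nbSeq q X.adjOp j x x₀ := by
  obtain ⟨f, hf, hout, -⟩ := X.exists_nonbacktracking_flow hq x₀ j
  rw [← hout]
  refine Finset.sum_nonneg fun y _ => ?_
  by_cases hy : X.mult x y = 0
  · simp [hy]
  · exact mul_nonneg (Nat.cast_nonneg _) (hf x y hy)

theorem sum_nbSeq_adjOp (hq : q ≠ 0) (X : RegularMultigraph V q) (j : ℕ) (x₀ : V) :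
    ∑ x, nbSeq q X.adjOp j x x₀ = 1 := by
  have hq0 : (q : ℝ) ≠ 0 := by exact_mod_cast hq
  induction j using Nat.twoStepInduction with
  | zero => simp [nbSeq, Matrix.one_apply]
  | one => simpa [nbSeq] using X.sum_adjOp x₀
  | more j h0 h1 =>
    simp only [nbSeq, Matrix.smul_apply, Matrix.sub_apply, smul_eq_mul]
    rw [← Finset.mul_sum, Finset.sum_sub_distrib, ← Finset.mul_sum, sum_adjOp_mul_apply, h0, h1]
    field_simp; ring

theorem nbSeq_adjOp_comm (X : RegularMultigraph V q) (j : ℕ) (x y : V) :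
    nbSeq q X.adjOp j x y = nbSeq q X.adjOp j y x := by
  have hT : X.adjOpᵀ = X.adjOp := by ext a b; exact X.adjOp_comm b a
  have hc : ∀ i, Commute X.adjOp (nbSeq q X.adjOp i) := by
    intro i
    induction i using Nat.twoStepInduction with
    | zero => simp [nbSeq]
    | one => simp [nbSeq]
    | more i h0 h1 =>
      exact ((((Commute.refl _).mul_right h1).smul_right _).sub_right h0).smul_right _
  have : (nbSeq q X.adjOp j)ᵀ = nbSeq q X.adjOp j := by
    induction j using Nat.twoStepInduction with
    | zero => simp [nbSeq]
    | one => simpa [nbSeq] using hT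
    | more j h0 h1 =>
      simp only [nbSeq, Matrix.transpose_smul, Matrix.transpose_sub, Matrix.transpose_mul, h0, h1,
        hT]
      rw [(hc _).eq]
  conv_lhs => rw [← this]
  rfl

/-- The simple random walk is a mixture of non-backtracking walks whose lengths follow the
distance from the root of the simple random walk on the `(q + 1)`-regular tree. If the
non-backtracking walks of lengths in `(R, K]` are `η`-close to uniform, then so is the simple
random walk, up to an error that controls the event that the length is at most `R` by the
exponential moment `E s ^ (-length) ≤ ρ ^ k`, `ρ = (q / s + s) / (q + 1)`. -/
theorem l1Dist_adjOp_pow_mul_nbSeq_le (hq : q ≠ 0) [Nonempty V] (X : RegularMultigraph V q)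
    (x₀ : V) {η s R : ℝ} {K : ℕ} (hη : 0 ≤ η) (hs : 1 ≤ s)
    (h : ∀ j : ℕ, R < j → j ≤ K → l1Dist (nbSeq q X.adjOp j) x₀ ≤ η) (k m : ℕ) (hk : m + k ≤ K) :
    l1Dist (X.adjOp ^ k * nbSeq q X.adjOp m) x₀ ≤
      η + 2 * s ^ R * (((q : ℝ) / s + s) / (q + 1)) ^ k * (1 / s) ^ m := by
  have hs0 : 0 < s := by linarith
  have hq0 : (0 : ℝ) < q := by exact_mod_cast Nat.pos_of_ne_zero hq
  have hsR : 0 < s ^ R := Real.rpow_pos_of_pos hs0 R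
  induction k generalizing m with
  | zero =>
    simp only [pow_zero, one_mul, mul_one]
    by_cases hm : R < m
    · exact (h m hm (by omega)).trans (le_add_of_nonneg_right (by positivity))
    · have h2 := l1Dist_le_two (x₀ := x₀) (fun x => X.nbSeq_adjOp_nonneg hq m x x₀)
        (X.sum_nbSeq_adjOp hq m x₀)
      have h3 : 1 ≤ s ^ R * (1 / s) ^ m := by
        rw [one_div, inv_pow, ← Real.rpow_natCast, ← div_eq_mul_inv, ← Real.rpow_sub hs0]
        exact Real.one_le_rpow hs (by linarith)
      linarith
  | succ k ih =>
    set ρ := ((q : ℝ) / s + s) / (q + 1) with hρ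
    have hρ0 : 0 < ρ := by positivity
    rw [pow_succ, Matrix.mul_assoc]
    rcases m with _ | m
    · have e : X.adjOp * nbSeq q X.adjOp 0 = nbSeq q X.adjOp 1 := by simp [nbSeq]
      rw [e]
      refine (ih 1 (by omega)).trans ?_
      have h1 : 1 / s ≤ ρ := by
        rw [hρ, div_le_div_iff₀ hs0 (by positivity)]
        have : ((q : ℝ) / s + s) * s = q + s ^ 2 := by field_simp
        nlinarith
      have h2 : 0 ≤ 2 * s ^ R * ρ ^ k := by positivity
      have := mul_le_mul_of_nonneg_left h1 h2
      rw [pow_one, pow_zero, mul_one, pow_succ]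
      linarith
    · rw [mul_nbSeq_succ hq, Matrix.mul_add, Matrix.mul_smul, Matrix.mul_smul]
      have i1 := ih (m + 2) (by omega)
      have i2 := ih m (by omega)
      set M1 := X.adjOp ^ k * nbSeq q X.adjOp (m + 2)
      set M2 := X.adjOp ^ k * nbSeq q X.adjOp m
      have hc : l1Dist (((q : ℝ) / (q + 1)) • M1 + (1 / ((q : ℝ) + 1)) • M2) x₀ ≤
          (q : ℝ) / (q + 1) * l1Dist M1 x₀ + 1 / ((q : ℝ) + 1) * l1Dist M2 x₀ := by
        simp only [l1Dist, Finset.mul_sum, ← Finset.sum_add_distrib]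
        refine Finset.sum_le_sum fun x _ => ?_
        have a1 : (0 : ℝ) ≤ (q : ℝ) / (q + 1) := by positivity
        have a2 : (0 : ℝ) ≤ 1 / ((q : ℝ) + 1) := by positivity
        rw [← abs_of_nonneg a1, ← abs_of_nonneg a2, ← abs_mul, ← abs_mul, abs_of_nonneg a1,
          abs_of_nonneg a2]
        refine le_trans (le_of_eq ?_) (abs_add_le _ _)
        congr 1
        simp only [Matrix.add_apply, Matrix.smul_apply, smul_eq_mul]
        field_simp
        ring
      refine hc.trans ?_
      calc (q : ℝ) / (q + 1) * l1Dist M1 x₀ + 1 / ((q : ℝ) + 1) * l1Dist M2 x₀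
          ≤ (q : ℝ) / (q + 1) * (η + 2 * s ^ R * ρ ^ k * (1 / s) ^ (m + 2)) +
            1 / ((q : ℝ) + 1) * (η + 2 * s ^ R * ρ ^ k * (1 / s) ^ m) := by gcongr
        _ = η + 2 * s ^ R * ρ ^ (k + 1) * (1 / s) ^ (m + 1) := by
          have e1 : (q : ℝ) / (q + 1) * (1 / s) ^ 2 + 1 / ((q : ℝ) + 1) = ρ * (1 / s) := by
            rw [hρ]
            field_simp
          have e2 : (q : ℝ) / (q + 1) + 1 / ((q : ℝ) + 1) = 1 := by field_simp
          linear_combination η * e2 + 2 * s ^ R * ρ ^ k * (1 / s) ^ m * e1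

end RegularMultigraph

/-! ### The trace formula -/

namespace RegularMultigraph

variable {V : Type u} [Fintype V] {q : ℕ}

theorem IsConnected.apply_eq_of_forall_mult {X : RegularMultigraph V q} (hX : X.IsConnected)
    {α : Type*} {f : V → α} (h : ∀ x y, X.mult x y ≠ 0 → f x = f y) (x y : V) : f x = f y := by
  obtain ⟨w⟩ := hX.preconnected x y
  induction w with
  | nil => rfl
  | cons hadj _ ih => exact (h _ _ hadj.2).trans ih

/-- For an eigenfunction `f` with eigenvalue `σ = ±1`, the Dirichlet form
`∑ (f x - σ f y) ^ 2` over the edges vanishes. -/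
theorem eq_mul_of_adjOp_mulVec_eq (X : RegularMultigraph V q) {f : V → ℝ} {σ : ℝ}
    (hσ : σ ^ 2 = 1) (hf : X.adjOp *ᵥ f = σ • f) (x y : V) (hxy : X.mult x y ≠ 0) :
    f x = σ * f y := by
  have hsum : ∑ x, ∑ y, X.adjOp x y * (f x - σ * f y) ^ 2 = 0 := by
    have e : ∀ x y, X.adjOp x y * (f x - σ * f y) ^ 2 =
        X.adjOp x y * f x ^ 2 - 2 * σ * (f x * (X.adjOp x y * f y)) + X.adjOp x y * f y ^ 2 := by
      intro x y
      linear_combination X.adjOp x y * f y ^ 2 * hσ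
    simp_rw [e, Finset.sum_add_distrib, Finset.sum_sub_distrib]
    have h1 : ∑ x, ∑ y, X.adjOp x y * f x ^ 2 = ∑ x, f x ^ 2 := by
      refine Finset.sum_congr rfl fun x _ => ?_
      simp_rw [X.adjOp_comm x]
      rw [← Finset.sum_mul, sum_adjOp, one_mul]
    have h2 : ∑ x, ∑ y, X.adjOp x y * f y ^ 2 = ∑ x, f x ^ 2 := by
      rw [Finset.sum_comm]
      refine Finset.sum_congr rfl fun x _ => ?_
      rw [← Finset.sum_mul, sum_adjOp, one_mul]
    have h3 : ∑ x, ∑ y, 2 * σ * (f x * (X.adjOp x y * f y)) = 2 * ∑ x, f x ^ 2 := by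
      rw [Finset.mul_sum]
      refine Finset.sum_congr rfl fun x _ => ?_
      rw [← Finset.mul_sum, ← Finset.mul_sum]
      have h4 : ∑ y, X.adjOp x y * f y = σ * f x := congrFun hf x
      rw [h4]
      linear_combination 2 * f x ^ 2 * hσ
    rw [h1, h2, h3]
    ring
  have h0 : ∀ x y, 0 ≤ X.adjOp x y * (f x - σ * f y) ^ 2 := fun x y =>
    mul_nonneg (X.adjOp_nonneg x y) (sq_nonneg _)
  rw [Finset.sum_eq_zero_iff_of_nonneg fun x _ => Finset.sum_nonneg fun y _ => h0 x y] at hsum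
  have hx := hsum x (Finset.mem_univ _)
  rw [Finset.sum_eq_zero_iff_of_nonneg fun y _ => h0 x y] at hx
  have hy := hx y (Finset.mem_univ _)
  have hA : X.adjOp x y ≠ 0 := by
    rw [adjOp_apply]
    exact div_ne_zero (by exact_mod_cast hxy) (by positivity)
  exact sub_eq_zero.1 (pow_eq_zero_iff two_ne_zero |>.1 ((mul_eq_zero.1 hy).resolve_left hA))

theorem IsConnected.apply_eq_of_adjOp_mulVec_eq {X : RegularMultigraph V q} (hX : X.IsConnected)
    {f : V → ℝ} (hf : X.adjOp *ᵥ f = f) (x y : V) : f x = f y :=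
  hX.apply_eq_of_forall_mult (fun a b hab => by
    simpa using X.eq_mul_of_adjOp_mulVec_eq (σ := 1) (by norm_num) (by simpa using hf) a b hab) x y

theorem IsConnected.eq_zero_of_adjOp_mulVec_eq_neg {X : RegularMultigraph V q}
    (hX : X.IsConnected) (hb : ¬ X.IsBipartite) {f : V → ℝ} (hf : X.adjOp *ᵥ f = -f) : f = 0 := by
  have h1 : ∀ a b, X.mult a b ≠ 0 → f a = -f b := fun a b hab => by
    simpa using X.eq_mul_of_adjOp_mulVec_eq (σ := -1) (by norm_num) (by simpa using hf) a b hab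
  have h2 := hX.apply_eq_of_forall_mult (f := fun x => |f x|) fun a b hab => by
    simp [h1 a b hab]
  by_contra hne
  obtain ⟨x, hx⟩ := Function.ne_iff.1 hne
  refine hb ⟨fun y => decide (0 < f y), fun a b hab => ?_⟩
  have ha : f a ≠ 0 := by
    have := h2 a x
    rw [← abs_pos, this]
    exact abs_pos.2 hx
  have := h1 a b hab
  simp only [ne_eq, decide_eq_decide]
  rcases lt_or_gt_of_ne ha with h | h
  · exact fun hh => absurd (hh.2 (by linarith)) (by linarith)
  · exact fun hh => absurd (hh.1 h) (by linarith)

variable [DecidableEq V]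

theorem exists_eigenvector (X : RegularMultigraph V q) :
    ∃ v : Fin (Fintype.card V) → EuclideanSpace ℝ V, Orthonormal ℝ v ∧
      ∀ j, X.adjOp *ᵥ ⇑(v j) = X.eigenvalue j • ⇑(v j) := by
  refine ⟨fun j => X.adjOp_isHermitian.eigenvectorBasis
    (Fintype.equivOfCardEq (Fintype.card_fin _) j), ?_, fun j => ?_⟩
  · exact X.adjOp_isHermitian.eigenvectorBasis.orthonormal.comp _ (Equiv.injective _)
  · rw [X.adjOp_isHermitian.mulVec_eigenvectorBasis]
    simp [Matrix.IsHermitian.eigenvalues, eigenvalue]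

theorem IsConnected.eigenvalue_ne_neg_one {X : RegularMultigraph V q} (hX : X.IsConnected)
    (hb : ¬ X.IsBipartite) (j : Fin (Fintype.card V)) : X.eigenvalue j ≠ -1 := by
  intro h
  obtain ⟨v, hv, hA⟩ := X.exists_eigenvector
  have := hX.eq_zero_of_adjOp_mulVec_eq_neg hb (f := v j) (by rw [hA, h, neg_one_smul])
  refine hv.ne_zero j ?_
  ext x
  exact congrFun this x

theorem IsConnected.eigenvalue_eq_one_unique {X : RegularMultigraph V q} (hX : X.IsConnected)
    {i j : Fin (Fintype.card V)} (hi : X.eigenvalue i = 1) (hj : X.eigenvalue j = 1) : i = j := by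
  obtain ⟨v, hv, hA⟩ := X.exists_eigenvector
  have : Nonempty V := hX.nonempty
  obtain ⟨x⟩ := this
  have hc : ∀ l, X.eigenvalue l = 1 → ∀ y, v l y = v l x := fun l hl y =>
    hX.apply_eq_of_adjOp_mulVec_eq (f := v l) (by rw [hA, hl, one_smul]) y x
  have h0 : ∀ l, X.eigenvalue l = 1 → v l x ≠ 0 := fun l hl h => by
    refine hv.ne_zero l ?_
    ext y
    simp [hc l hl y, h]
  by_contra hij
  have h := hv.inner_eq_zero hij
  rw [PiLp.inner_apply] at h
  simp only [hc i hi, hc j hj, Finset.sum_const, Finset.card_univ, nsmul_eq_mul,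
    RCLike.inner_apply, conj_trivial] at h
  have hn : (Fintype.card V : ℝ) ≠ 0 := by
    have : Nonempty V := ⟨x⟩
    exact_mod_cast Fintype.card_ne_zero
  exact mul_ne_zero hn (mul_ne_zero (h0 j hj) (h0 i hi)) h

theorem trace_nbSeq_mul_self (X : RegularMultigraph V q) (j : ℕ) :
    (nbSeq q X.adjOp j * nbSeq q X.adjOp j).trace = ∑ i, nbSeq q (X.eigenvalue i) j ^ 2 := by
  have hA := X.adjOp_isHermitian
  set φ := (Unitary.conjStarAlgAut ℝ (Matrix V V ℝ) (star hA.eigenvectorUnitary)) with hφ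
  have hφA : φ X.adjOp = Matrix.diagonalAlgHom ℝ hA.eigenvalues := by
    rw [hφ, hA.conjStarAlgAut_star_eigenvectorUnitary]
    rfl
  have h1 : φ (nbSeq q X.adjOp j) = Matrix.diagonal fun x => nbSeq q (hA.eigenvalues x) j := by
    have e1 : φ (nbSeq q X.adjOp j) = nbSeq q (φ X.adjOp) j :=
      map_nbSeq q (φ.toAlgEquiv : Matrix V V ℝ →ₐ[ℝ] Matrix V V ℝ) _ j
    rw [e1, hφA, ← map_nbSeq]
    change Matrix.diagonal _ = _
    congr 1
    funext x
    exact map_nbSeq q (Pi.evalAlgHom ℝ (fun _ : V => ℝ) x) _ j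
  have htr : ∀ M, (φ M).trace = M.trace := by
    intro M
    rw [hφ, Unitary.conjStarAlgAut_star_apply, Matrix.trace_mul_cycle,
      Unitary.mul_star_self_of_mem hA.eigenvectorUnitary.2, one_mul]
  rw [← htr, map_mul, h1, Matrix.diagonal_mul_diagonal, Matrix.trace_diagonal]
  have e : ∀ x, hA.eigenvalues x =
      X.eigenvalue ((Fintype.equivOfCardEq (Fintype.card_fin _)).symm x) := fun _ => rfl
  simp_rw [e, ← sq]
  exact Equiv.sum_comp _ fun i => nbSeq q (X.eigenvalue i) j ^ 2

theorem sum_sum_nbSeq_sub_sq (hq : q ≠ 0) [Nonempty V] (X : RegularMultigraph V q) (j : ℕ) :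
    ∑ x₀, ∑ x, (nbSeq q X.adjOp j x x₀ - 1 / (Fintype.card V : ℝ)) ^ 2 =
      ∑ i, nbSeq q (X.eigenvalue i) j ^ 2 - 1 := by
  have hn : (Fintype.card V : ℝ) ≠ 0 := by exact_mod_cast Fintype.card_ne_zero
  have h : ∀ x₀, ∑ x, (nbSeq q X.adjOp j x x₀ - 1 / (Fintype.card V : ℝ)) ^ 2 =
      (∑ x, nbSeq q X.adjOp j x₀ x * nbSeq q X.adjOp j x x₀) - 1 / (Fintype.card V : ℝ) := by
    intro x₀
    simp_rw [sub_sq, Finset.sum_add_distrib, Finset.sum_sub_distrib, ← Finset.sum_mul,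
      ← Finset.mul_sum, X.sum_nbSeq_adjOp hq, Finset.sum_const, Finset.card_univ, nsmul_eq_mul]
    have : ∀ x, nbSeq q X.adjOp j x₀ x * nbSeq q X.adjOp j x x₀ = nbSeq q X.adjOp j x x₀ ^ 2 :=
      fun x => by rw [X.nbSeq_adjOp_comm j x₀ x, sq]
    simp_rw [this]
    field_simp
    ring
  simp_rw [h, Finset.sum_sub_distrib, Finset.sum_const, Finset.card_univ, nsmul_eq_mul,
    mul_one_div_cancel hn, ← trace_nbSeq_mul_self]
  rfl

/-- The Hilbert-Schmidt norm of the non-backtracking operator on the complement of the constants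
is the sum over the eigenvalues other than `± 1`. -/
theorem IsConnected.sum_sum_nbSeq_sub_sq_le (hq : q ≠ 0) {X : RegularMultigraph V q}
    (hX : X.IsConnected) (hb : ¬ X.IsBipartite) (j : ℕ) :
    ∑ x₀, ∑ x, (nbSeq q X.adjOp j x x₀ - 1 / (Fintype.card V : ℝ)) ^ 2 ≤
      ∑ i with X.eigenvalue i ≠ 1 ∧ X.eigenvalue i ≠ -1, nbSeq q (X.eigenvalue i) j ^ 2 := by
  have : Nonempty V := hX.nonempty
  have hq0 : (q : ℝ) ≠ 0 := by exact_mod_cast hq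
  have h1 : nbSeq q (1 : ℝ) j = 1 := by
    induction j using Nat.twoStepInduction with
    | zero => simp [nbSeq]
    | one => simp [nbSeq]
    | more j h0 h1 =>
      simp only [nbSeq, h0, h1, smul_eq_mul]
      field_simp; ring
  rw [sum_sum_nbSeq_sub_sq hq, ← Finset.sum_filter_add_sum_filter_not Finset.univ
    (fun i => X.eigenvalue i ≠ 1 ∧ X.eigenvalue i ≠ -1)]
  have hle : ∑ i with ¬ (X.eigenvalue i ≠ 1 ∧ X.eigenvalue i ≠ -1),
      nbSeq q (X.eigenvalue i) j ^ 2 ≤ 1 := by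
    have hm : ∀ i ∈ Finset.univ.filter
        (fun i => ¬ (X.eigenvalue i ≠ 1 ∧ X.eigenvalue i ≠ -1)), X.eigenvalue i = 1 := by
      intro i hi
      have := (Finset.mem_filter.1 hi).2
      by_contra hne
      exact this ⟨hne, hX.eigenvalue_ne_neg_one hb i⟩
    rw [Finset.sum_congr rfl fun i hi => by rw [hm i hi, h1, one_pow], Finset.sum_const,
      nsmul_eq_mul, mul_one]
    exact_mod_cast Finset.card_le_one.2 fun a ha b hb =>
      hX.eigenvalue_eq_one_unique (hm a ha) (hm b hb)
  linarith

end RegularMultigraph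

/-! ### Growth of the spherical functions -/

/-- The roots of `z² - τ z + c` with `τ` real lie in the disc of radius `r ≥ √c` if `|τ|` is at
most the sum of the roots `r` and `c / r`: complex roots have absolute value `√c`. -/
theorem norm_le_of_sq_sub_mul_add_eq_zero {c r τ : ℝ} (hc : 0 < c) (hr : 0 < r) (hcr : c ≤ r ^ 2)
    (hτ : |τ| ≤ r + c / r) {z : ℂ} (hz : z ^ 2 - τ * z + c = 0) : ‖z‖ ≤ r := by
  have hre := congrArg Complex.re hz
  have him := congrArg Complex.im hz
  simp only [sq, Complex.add_re, Complex.sub_re, Complex.mul_re, Complex.ofReal_re,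
    Complex.ofReal_im, Complex.zero_re, Complex.add_im, Complex.sub_im, Complex.mul_im,
    Complex.zero_im] at hre him
  rw [← sq_le_sq₀ (norm_nonneg z) hr.le, ← Complex.normSq_eq_norm_sq, Complex.normSq_apply]
  by_cases hy : z.im = 0
  · -- A real root: `t = |z|` satisfies `t + c / t ≤ r + c / r`, hence `t ≤ r`.
    simp only [hy, mul_zero, sub_zero, add_zero] at hre ⊢
    by_contra! hlt
    have ht : r < |z.re| := by
      rw [← abs_of_pos hr]; exact sq_lt_sq.1 (by nlinarith)
    have h1 : |z.re| ^ 2 + c ≤ |τ| * |z.re| := by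
      rw [sq_abs, ← abs_mul]
      have := le_abs_self (τ * z.re)
      nlinarith
    have h2 : |τ| * r ≤ r ^ 2 + c := by
      have := mul_le_mul_of_nonneg_right hτ hr.le
      have e : (r + c / r) * r = r ^ 2 + c := by field_simp
      linarith
    have h3 : (|z.re| ^ 2 + c) * r ≤ (r ^ 2 + c) * |z.re| := by
      have := mul_le_mul_of_nonneg_right h1 hr.le
      have := mul_le_mul_of_nonneg_right h2 (abs_nonneg z.re)
      nlinarith
    have h4 : 0 < (|z.re| - r) * (|z.re| * r - c) :=
      mul_pos (by linarith) (by nlinarith)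
    nlinarith
  · have hx : τ = 2 * z.re := by
      have : z.im * (2 * z.re - τ) = 0 := by linarith
      have := (mul_eq_zero.1 this).resolve_left hy
      linarith
    rw [hx] at hre
    nlinarith

/-- The value at `lam` of the spherical function is at most `(3 j + 1) q ^ (-j a)` if
`|lam| ≤ (q ^ a + q ^ (1 - a)) / (q + 1)`: both roots of `q z² - (q + 1) lam z + 1` have absolute
value at most `q ^ (-a)`. -/
theorem abs_nbSeq_le {q : ℕ} (hq : 2 ≤ q) {lam a : ℝ} (ha : a ≤ 1 / 2)
    (hlam : |lam| ≤ 1 / ((q : ℝ) + 1) * ((q : ℝ) ^ a + (q : ℝ) ^ (1 - a))) (j : ℕ) :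
    |nbSeq q lam j| ≤ (3 * j + 1) * ((q : ℝ) ^ (-a)) ^ j := by
  have hq2 : (2 : ℝ) ≤ q := by exact_mod_cast hq
  have hq0 : (0 : ℝ) < q := by linarith
  set r := (q : ℝ) ^ (-a) with hr
  set τ := ((q : ℝ) + 1) / q * lam with hτ
  have hr0 : 0 < r := Real.rpow_pos_of_pos hq0 _
  have hcr : 1 / (q : ℝ) ≤ r ^ 2 := by
    rw [hr, ← Real.rpow_natCast, ← Real.rpow_mul hq0.le, one_div, ← Real.rpow_neg_one]
    refine Real.rpow_le_rpow_of_exponent_le (by linarith) ?_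
    push_cast; linarith
  have hτr : |τ| ≤ r + 1 / q / r := by
    have e1 : 1 / (q : ℝ) / r = (q : ℝ) ^ a / q := by
      rw [hr, Real.rpow_neg hq0.le]; field_simp
    have e2 : (q : ℝ) ^ (1 - a) / q = r := by
      rw [hr, sub_eq_add_neg, Real.rpow_add hq0, Real.rpow_one]; field_simp
    rw [hτ, abs_mul, abs_of_pos (by positivity : 0 < ((q : ℝ) + 1) / q), e1, ← e2]
    calc ((q : ℝ) + 1) / q * |lam| ≤ ((q : ℝ) + 1) / q *
          (1 / ((q : ℝ) + 1) * ((q : ℝ) ^ a + (q : ℝ) ^ (1 - a))) := by gcongr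
      _ = _ := by field_simp; ring
  obtain ⟨w, hw⟩ := IsAlgClosed.exists_pow_nat_eq ((τ : ℂ) ^ 2 / 4 - (1 / q : ℝ)) zero_lt_two
  have hz1 := norm_le_of_sq_sub_mul_add_eq_zero (c := 1 / q) (by positivity) hr0 hcr hτr
    (z := τ / 2 + w) (by linear_combination hw)
  have hz2 := norm_le_of_sq_sub_mul_add_eq_zero (c := 1 / q) (by positivity) hr0 hcr hτr
    (z := τ / 2 - w) (by linear_combination hw)
  have hprod : ((τ : ℂ) / 2 + w) * (τ / 2 - w) = (1 / q : ℝ) := by linear_combination -hw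
  have hsum : ((τ : ℂ) / 2 + w) + (τ / 2 - w) = τ := by ring
  set z₁ : ℂ := τ / 2 + w
  set z₂ : ℂ := τ / 2 - w
  have hlr : |lam| ≤ 2 * r := by
    have h1 : |τ| ≤ 2 * r := by
      rw [← Real.norm_eq_abs, ← Complex.norm_real, ← hsum]
      exact (norm_add_le _ _).trans (by linarith)
    refine le_trans ?_ h1
    rw [hτ, abs_mul]
    refine le_mul_of_one_le_left (abs_nonneg _) ((le_abs_self _).trans' ?_)
    rw [le_div_iff₀ hq0]; linarith
  -- Factor the recursion as `(E - z₁) (E - z₂) = 0` for the shift `E`.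
  have hstep : ∀ j, ((nbSeq q lam (j + 1) : ℝ) : ℂ) = z₁ * (nbSeq q lam j : ℝ) +
      z₂ ^ j * (lam - z₁) := by
    intro j
    induction j with
    | zero => simp [nbSeq]
    | succ j ih =>
      have hrec : nbSeq q lam (j + 2) = τ * nbSeq q lam (j + 1) - 1 / q * nbSeq q lam j := by
        simp only [nbSeq, smul_eq_mul, hτ]
        field_simp
      rw [show j + 1 + 1 = j + 2 from rfl, hrec]
      push_cast at hprod ⊢
      rw [← hprod, ← hsum]
      linear_combination z₂ * ih
  rw [← Real.norm_eq_abs, ← Complex.norm_real]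
  induction j with
  | zero => simp [nbSeq]
  | succ j ih =>
    rw [hstep]
    have h0 : ‖(lam : ℂ) - z₁‖ ≤ 3 * r := by
      refine (norm_sub_le _ _).trans ?_
      rw [Complex.norm_real, Real.norm_eq_abs]
      linarith
    calc _ ≤ ‖z₁‖ * ‖((nbSeq q lam j : ℝ) : ℂ)‖ + ‖z₂‖ ^ j * ‖(lam : ℂ) - z₁‖ := by
          refine (norm_add_le _ _).trans ?_
          rw [norm_mul, norm_mul, norm_pow]
      _ ≤ r * ((3 * j + 1) * r ^ j) + r ^ j * (3 * r) := by gcongr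
      _ = _ := by push_cast; ring

/-! ### Summation over the spectrum -/

/-- An eigenvalue of absolute value at most `b < 1` is governed by an exponent `a = 1 / p` in
`[a₀, 1 / 2]`, where `a₀ > 0` depends only on `b` and `q`. -/
theorem exists_exponent {q : ℕ} (hq : 2 ≤ q) {b : ℝ} (hb : b < 1) :
    ∃ a₀ : ℝ, 0 < a₀ ∧ ∀ lam : ℝ, |lam| ≤ b → ∃ a : ℝ, a₀ ≤ a ∧ a ≤ 1 / 2 ∧
      |lam| ≤ 1 / ((q : ℝ) + 1) * ((q : ℝ) ^ a + (q : ℝ) ^ (1 - a)) ∧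
      (a < 1 / 2 → IsPValue q lam (ENNReal.ofReal (1 / a))) := by
  have hq2 : (2 : ℝ) ≤ q := by exact_mod_cast hq
  have hq0 : (0 : ℝ) < q := by linarith
  set φ : ℝ → ℝ := fun a => 1 / ((q : ℝ) + 1) * ((q : ℝ) ^ a + (q : ℝ) ^ (1 - a)) with hφ
  have hcont : Continuous φ := by
    have h1 : Continuous fun a : ℝ => (q : ℝ) ^ a := Real.continuous_const_rpow hq0.ne'
    exact continuous_const.mul (h1.add (h1.comp (continuous_const.sub continuous_id)))
  have hφ0 : φ 0 = 1 := by
    simp only [hφ, Real.rpow_zero, sub_zero, Real.rpow_one]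
    field_simp; ring
  have hhalf : φ (1 / 2) = 2 / ((q : ℝ) + 1) * √(q : ℝ) := by
    simp only [hφ]
    rw [show (1 : ℝ) - 1 / 2 = 1 / 2 by norm_num, ← Real.sqrt_eq_rpow]
    ring
  have hev : ∀ᶠ a in nhdsWithin (0 : ℝ) (Set.Ioi 0), b < φ a ∧ a < 1 / 2 ∧ 0 < a := by
    have h1 : ∀ᶠ a in nhds (0 : ℝ), b < φ a :=
      hcont.continuousAt.eventually_const_lt (by rw [hφ0]; exact hb)
    have h2 : ∀ᶠ a in nhds (0 : ℝ), a < 1 / 2 := eventually_lt_nhds (by norm_num)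
    filter_upwards [nhdsWithin_le_nhds h1, nhdsWithin_le_nhds h2, self_mem_nhdsWithin]
      with a ha1 ha2 ha3 using ⟨ha1, ha2, ha3⟩
  obtain ⟨a₀, hba, ha12, ha0⟩ := hev.exists
  refine ⟨a₀, ha0, fun lam hlam => ?_⟩
  by_cases ht : |lam| ≤ φ (1 / 2)
  · exact ⟨1 / 2, ha12.le, le_rfl, ht, fun h => absurd h (lt_irrefl _)⟩
  · push Not at ht
    obtain ⟨a, ⟨h1, h2⟩, h3⟩ := intermediate_value_Icc' ha12.le hcont.continuousOn
      (⟨ht.le, hlam.trans hba.le⟩ : |lam| ∈ Set.Icc (φ (1 / 2)) (φ a₀))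
    refine ⟨a, h1, h2, h3.ge, fun hlt => Or.inr ⟨by rw [← hhalf]; exact ht, ?_, ?_⟩⟩
    · have ha : 0 < a := ha0.trans_le h1
      rw [show (2 : ℝ≥0∞) = ENNReal.ofReal 2 by simp,
        ENNReal.ofReal_lt_ofReal_iff (by positivity), lt_div_iff₀ ha]
      linarith
    · have ha : 0 < a := ha0.trans_le h1
      rw [ENNReal.toReal_inv, ENNReal.toReal_ofReal (by positivity),
        show (1 / a)⁻¹ = a by rw [one_div, inv_inv], ← h3]

/-- If at most `C n ^ (2 α + δ)` of the exponents `aᵢ` are at most `α`, then the sum of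
`n ^ (-(2 + ε) aᵢ)` is small, because all `aᵢ` are at least `a₀ > 0`. -/
theorem sum_rpow_neg_le {ι : Type*} (s : Finset ι) (a : ι → ℝ) {n a₀ δ C ε : ℝ} (hn : 1 ≤ n)
    (hε : 0 ≤ ε) (ha₀ : 0 < a₀) (hδ : 0 < δ) (ha : ∀ i ∈ s, a₀ ≤ a i) (ha' : ∀ i ∈ s, a i ≤ 1 / 2)
    (hC : ∀ α : ℝ, 0 < α → ((s.filter fun i => a i ≤ α).card : ℝ) ≤ C * n ^ (2 * α + δ)) :
    ∑ i ∈ s, n ^ (-((2 + ε) * a i)) ≤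
      ((⌊1 / 2 / δ⌋₊ + 1 : ℕ) : ℝ) * (C * n ^ (3 * δ - ε * a₀)) := by
  have hn0 : 0 < n := by linarith
  have hmaps : ∀ i ∈ s, ⌊a i / δ⌋₊ ∈ Finset.range (⌊1 / 2 / δ⌋₊ + 1) := fun i hi => by
    rw [Finset.mem_range, Nat.lt_succ_iff]
    exact Nat.floor_le_floor (div_le_div_of_nonneg_right (ha' i hi) hδ.le)
  rw [← Finset.sum_fiberwise_of_maps_to hmaps]
  refine (Finset.sum_le_card_nsmul _ _ (C * n ^ (3 * δ - ε * a₀)) fun m _ => ?_).trans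
    (by rw [Finset.card_range, nsmul_eq_mul])
  -- The exponents in the bucket `m` lie in `[m δ, (m + 1) δ)`.
  have hterm : ∀ i ∈ s.filter (fun i => ⌊a i / δ⌋₊ = m),
      n ^ (-((2 + ε) * a i)) ≤ n ^ (-(2 * m * δ + ε * a₀)) := by
    intro i hi
    obtain ⟨his, him⟩ := Finset.mem_filter.1 hi
    have hai := ha i his
    have h1 : (m : ℝ) * δ ≤ a i := by
      rw [← him, ← le_div_iff₀ hδ]
      exact Nat.floor_le (div_nonneg (ha₀.le.trans hai) hδ.le)
    refine Real.rpow_le_rpow_of_exponent_le hn ?_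
    have := mul_le_mul_of_nonneg_left hai hε
    linarith
  have hcard : ((s.filter fun i => ⌊a i / δ⌋₊ = m).card : ℝ) ≤
      C * n ^ (2 * ((m + 1) * δ) + δ) := by
    refine le_trans ?_ (hC ((m + 1) * δ) (by positivity))
    refine Nat.cast_le.2 (Finset.card_le_card fun i hi => ?_)
    obtain ⟨his, him⟩ := Finset.mem_filter.1 hi
    refine Finset.mem_filter.2 ⟨his, ?_⟩
    rw [← div_le_iff₀ hδ, ← him]
    exact (Nat.lt_floor_add_one _).le
  refine (Finset.sum_le_card_nsmul _ _ _ hterm).trans ?_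
  rw [nsmul_eq_mul]
  refine (mul_le_mul_of_nonneg_right hcard (Real.rpow_nonneg hn0.le _)).trans (le_of_eq ?_)
  rw [mul_assoc, ← Real.rpow_add hn0]
  congr 2
  ring

/-- In an expander family with the density property, the non-backtracking operators of lengths
`j > (1 + ε / 2) log_q n` have Hilbert-Schmidt norm at most `(3 j + 1) n ^ (-η / 2)` on the
complement of the constants, up to a constant. -/
theorem exists_sum_nbSeq_sq_le {q : ℕ} (hq : 2 ≤ q) {ι : Type v} {V : ι → Type u}
    [∀ i, Fintype (V i)] [∀ i, DecidableEq (V i)] (X : ∀ i, RegularMultigraph (V i) q)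
    (hX : ∀ i, (X i).IsConnected) (hexp : IsExpanderFamily X) (hSX : SarnakXueDensity X)
    {ε : ℝ} (hε : 0 < ε) :
    ∃ η : ℝ, 0 < η ∧ ∃ C : ℝ, 0 ≤ C ∧ ∀ i, ∀ j : ℕ,
      (1 + ε / 2) * Real.logb q (Fintype.card (V i)) < j →
      ∑ l with (X i).eigenvalue l ≠ 1 ∧ (X i).eigenvalue l ≠ -1,
        nbSeq q ((X i).eigenvalue l) j ^ 2 ≤
      C * (3 * j + 1) ^ 2 * (Fintype.card (V i) : ℝ) ^ (-η) := by
  obtain ⟨b, hb, hbX⟩ := hexp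
  obtain ⟨a₀, ha₀, hexpo⟩ := exists_exponent hq hb
  have hq2 : (2 : ℝ) ≤ q := by exact_mod_cast hq
  have hq0 : (0 : ℝ) < q := by linarith
  set δ := ε * a₀ / 6 with hδ
  have hδ0 : 0 < δ := by positivity
  obtain ⟨C, hC⟩ := hSX δ hδ0
  refine ⟨ε * a₀ / 2, by positivity, ((⌊1 / 2 / δ⌋₊ + 1 : ℕ) : ℝ) * max C 1, by positivity,
    fun i j hj => ?_⟩
  have : Nonempty (V i) := (hX i).nonempty
  set n := Fintype.card (V i) with hn
  have hn1 : (1 : ℝ) ≤ n := by exact_mod_cast Fintype.card_pos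
  have hn0 : (0 : ℝ) < n := by linarith
  have hL : (q : ℝ) ^ Real.logb q n = n := Real.rpow_logb hq0 (by linarith) hn0
  set s := Finset.univ.filter fun l => (X i).eigenvalue l ≠ 1 ∧ (X i).eigenvalue l ≠ -1
  have hs : ∀ l ∈ s, |(X i).eigenvalue l| ≤ b := fun l hl =>
    hbX i l (Finset.mem_filter.1 hl).2.1 (Finset.mem_filter.1 hl).2.2
  choose! a h1 h2 h3 h4 using fun l (hl : l ∈ s) => hexpo _ (hs l hl)
  have hcount : ∀ α : ℝ, 0 < α →
      ((s.filter fun l => a l ≤ α).card : ℝ) ≤ max C 1 * (n : ℝ) ^ (2 * α + δ) := by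
    intro α hα
    have hpos : (0 : ℝ) ≤ (n : ℝ) ^ (2 * α + δ) := Real.rpow_nonneg hn0.le _
    by_cases hα2 : α < 1 / 2
    · refine le_trans ?_ (mul_le_mul_of_nonneg_right (le_max_left C 1) hpos)
      have hp := hC i (1 / α) (by rw [lt_div_iff₀ hα]; linarith)
      rw [show 2 / (1 / α) = 2 * α by field_simp] at hp
      refine le_trans ?_ hp
      rw [← Set.ncard_coe_finset]
      refine Nat.cast_le.2 (Set.ncard_le_ncard (fun l hl => ?_) (Set.toFinite _))
      obtain ⟨hls, hla⟩ := Finset.mem_filter.1 (Finset.mem_coe.1 hl)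
      refine ⟨_, h4 l hls (by linarith), ENNReal.ofReal_le_ofReal ?_⟩
      exact one_div_le_one_div_of_le (ha₀.trans_le (h1 l hls)) hla
    · refine le_trans ?_ (mul_le_mul_of_nonneg_right (le_max_right C 1) hpos)
      rw [one_mul]
      calc ((s.filter fun l => a l ≤ α).card : ℝ) ≤ n := by
            have := Finset.card_le_univ (s.filter fun l => a l ≤ α)
            rw [Fintype.card_fin] at this
            exact_mod_cast this
        _ = (n : ℝ) ^ (1 : ℝ) := (Real.rpow_one _).symm
        _ ≤ _ := Real.rpow_le_rpow_of_exponent_le hn1 (by linarith)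
  have hmain := sum_rpow_neg_le s a hn1 hε.le ha₀ hδ0 h1 h2 hcount
  rw [show 3 * δ - ε * a₀ = -(ε * a₀ / 2) by rw [hδ]; ring] at hmain
  calc ∑ l ∈ s, nbSeq q ((X i).eigenvalue l) j ^ 2
      ≤ ∑ l ∈ s, (3 * (j : ℝ) + 1) ^ 2 * (n : ℝ) ^ (-((2 + ε) * a l)) := by
        refine Finset.sum_le_sum fun l hl => ?_
        have hb1 := abs_nbSeq_le hq (h2 l hl) (h3 l hl) j
        have hal : 0 < a l := ha₀.trans_le (h1 l hl)
        rw [← sq_abs]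
        refine (pow_le_pow_left₀ (abs_nonneg _) hb1 2).trans ?_
        rw [mul_pow]
        refine mul_le_mul_of_nonneg_left ?_ (by positivity)
        rw [← pow_mul, ← Real.rpow_natCast, ← Real.rpow_mul hq0.le]
        conv_rhs => rw [← hL]
        rw [← Real.rpow_mul hq0.le]
        refine Real.rpow_le_rpow_of_exponent_le (by linarith) ?_
        have := mul_le_mul_of_nonneg_right hj.le hal.le
        push_cast
        linarith
    _ ≤ (3 * (j : ℝ) + 1) ^ 2 * (((⌊1 / 2 / δ⌋₊ + 1 : ℕ) : ℝ) *
          (max C 1 * (n : ℝ) ^ (-(ε * a₀ / 2)))) := by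
        rw [← Finset.mul_sum]
        exact mul_le_mul_of_nonneg_left hmain (by positivity)
    _ = _ := by ring

/-! ### The upper bound -/

open Filter Topology

/-- A large deviation bound: a walk on `ℕ` with steps `1` and `-1` of probabilities `q / (q + 1)`
and `1 / (q + 1)` has speed `(q - 1) / (q + 1)`, hence is unlikely to be below `(1 + ε / 2) L` at
a time `K ≥ (1 + ε) L (q + 1) / (q - 1)`. -/
theorem exists_rpow_mul_pow_le_exp {q : ℕ} (hq : 2 ≤ q) {ε : ℝ} (hε : 0 < ε) :
    ∃ s : ℝ, 1 ≤ s ∧ ∃ γ : ℝ, 0 < γ ∧ ∀ L : ℝ, 0 ≤ L → ∀ K : ℕ,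
      (1 + ε) * (((q : ℝ) + 1) / ((q : ℝ) - 1)) * L ≤ K →
      s ^ ((1 + ε / 2) * L) * (((q : ℝ) / s + s) / (q + 1)) ^ K ≤ Real.exp (-(γ * L)) := by
  have hq2 : (2 : ℝ) ≤ q := by exact_mod_cast hq
  have hq1 : (0 : ℝ) < q - 1 := by linarith
  set t := ε / (8 * (1 + ε)) with ht
  have ht0 : 0 < t := by positivity
  have ht1 : 8 * (1 + ε) * t = ε := by rw [ht]; field_simp
  have ht2 : t < 1 := by nlinarith
  have hs0 : 0 < 1 + t := by linarith
  set β := t * (q - (1 + t)) / ((1 + t) * (q + 1)) with hβ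
  have hβ0 : 0 < β := div_pos (mul_pos ht0 (by linarith)) (by positivity)
  set κ := ((q : ℝ) + 1) / ((q : ℝ) - 1) with hκ
  refine ⟨1 + t, by linarith, β * ((1 + ε) * κ) - t * (1 + ε / 2), ?_, fun L hL K hK => ?_⟩
  · have e : β * ((1 + ε) * κ) = t * ((1 + ε) * ((q - (1 + t)) / ((1 + t) * (q - 1)))) := by
      rw [hβ, hκ]; field_simp
    have h1 : 1 - 2 * t ≤ (q - (1 + t)) / ((1 + t) * (q - 1)) := by
      rw [le_div_iff₀ (by positivity)]
      nlinarith [mul_nonneg ht0.le (by linarith : (0 : ℝ) ≤ q - 2),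
        mul_nonneg (mul_nonneg ht0.le ht0.le) hq1.le]
    have h2 : (1 + ε) * (1 - 2 * t) ≤ (1 + ε) * ((q - (1 + t)) / ((1 + t) * (q - 1))) := by
      gcongr
    have h3 : 1 + ε / 2 < (1 + ε) * (1 - 2 * t) := by nlinarith
    rw [e, ← mul_sub]
    exact mul_pos ht0 (by linarith)
  · have hρ : ((q : ℝ) / (1 + t) + (1 + t)) / (q + 1) = 1 - β := by
      rw [hβ]; field_simp; ring
    have hρ0 : 0 ≤ ((q : ℝ) / (1 + t) + (1 + t)) / (q + 1) := by positivity
    have h1 : (((q : ℝ) / (1 + t) + (1 + t)) / (q + 1)) ^ K ≤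
        Real.exp (-(β * ((1 + ε) * κ * L))) := by
      calc _ ≤ Real.exp (-β) ^ K := by
            refine pow_le_pow_left₀ hρ0 ?_ K
            rw [hρ]
            have := Real.add_one_le_exp (-β)
            linarith
        _ = Real.exp (-(β * K)) := by rw [← Real.exp_nat_mul]; congr 1; ring
        _ ≤ _ := Real.exp_le_exp.2 (neg_le_neg (mul_le_mul_of_nonneg_left hK hβ0.le))
    have h2 : (1 + t) ^ ((1 + ε / 2) * L) ≤ Real.exp (t * ((1 + ε / 2) * L)) := by
      rw [Real.rpow_def_of_pos hs0]
      refine Real.exp_le_exp.2 (mul_le_mul_of_nonneg_right ?_ (by positivity))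
      have := Real.log_le_sub_one_of_pos hs0
      linarith
    refine (mul_le_mul h2 h1 (pow_nonneg hρ0 K) (Real.exp_pos _).le).trans (le_of_eq ?_)
    rw [← Real.exp_add]
    congr 1
    ring

theorem tendsto_logb_natCast_atTop {q : ℕ} (hq : 2 ≤ q) :
    Tendsto (fun n : ℕ => Real.logb q n) atTop atTop :=
  (Real.tendsto_logb_atTop (by exact_mod_cast hq)).comp tendsto_natCast_atTop_atTop

theorem tendsto_natCast_rpow_neg {η : ℝ} (hη : 0 < η) :
    Tendsto (fun n : ℕ => (n : ℝ) ^ (-η)) atTop (𝓝 0) :=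
  (tendsto_rpow_neg_atTop hη).comp tendsto_natCast_atTop_atTop

theorem tendsto_exp_neg_mul_logb {q : ℕ} (hq : 2 ≤ q) {γ : ℝ} (hγ : 0 < γ) :
    Tendsto (fun n : ℕ => Real.exp (-(γ * Real.logb q n))) atTop (𝓝 0) :=
  Real.tendsto_exp_neg_atTop_nhds_zero.comp
    ((tendsto_logb_natCast_atTop hq).const_mul_atTop hγ)

theorem tendsto_affine_logb_pow_mul_rpow_neg {q : ℕ} {η : ℝ} (hη : 0 < η) (A B : ℝ) :
    Tendsto (fun n : ℕ => (A * Real.logb q n + B) ^ 3 * (n : ℝ) ^ (-η)) atTop (𝓝 0) := by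
  have h3 : 0 < η / 3 := by positivity
  have h1 : Tendsto (fun x : ℝ => Real.log x / x ^ (η / 3)) atTop (𝓝 0) :=
    (isLittleO_log_rpow_atTop h3).tendsto_div_nhds_zero
  have h2 := (((h1.comp tendsto_natCast_atTop_atTop).const_mul (A / Real.log q)).add
    ((tendsto_natCast_rpow_neg h3).const_mul B)).pow 3
  simp only [mul_zero, add_zero, ne_eq, OfNat.ofNat_ne_zero, not_false_eq_true, zero_pow] at h2
  refine h2.congr fun n => ?_
  have hn : (0 : ℝ) ≤ n := Nat.cast_nonneg n
  have e : (n : ℝ) ^ (-η) = ((n : ℝ) ^ (-(η / 3))) ^ 3 := by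
    rw [← Real.rpow_natCast, ← Real.rpow_mul hn]
    congr 1; push_cast; ring
  rw [e, ← mul_pow]
  congr 1
  simp only [Function.comp_apply, Real.logb, div_eq_mul_inv, Real.rpow_neg hn]
  ring

namespace RegularMultigraph

/-- Markov's inequality over the starting points of the non-backtracking walks. -/
theorem card_mul_sq_le {V : Type u} [Fintype V] [DecidableEq V] {q : ℕ}
    (X : RegularMultigraph V q) {K : ℕ} {R t E : ℝ} (ht : 0 ≤ t) (hE0 : 0 ≤ E)
    (hE : ∀ j : ℕ, R < j → j ≤ K →
      ∑ x₀, ∑ x, (nbSeq q X.adjOp j x x₀ - 1 / (Fintype.card V : ℝ)) ^ 2 ≤ E)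
    (B : Finset V) (hB : ∀ x₀ ∈ B, ∃ j : ℕ, R < j ∧ j ≤ K ∧ t < l1Dist (nbSeq q X.adjOp j) x₀) :
    B.card * t ^ 2 ≤ (K + 1) * (Fintype.card V * E) := by
  classical
  set J := (Finset.range (K + 1)).filter fun j : ℕ => R < j with hJ
  have h1 : (B.card : ℝ) * t ^ 2 ≤ ∑ x₀ ∈ B, ∑ j ∈ J, l1Dist (nbSeq q X.adjOp j) x₀ ^ 2 := by
    rw [← nsmul_eq_mul]
    refine Finset.card_nsmul_le_sum _ _ _ fun x₀ hx => ?_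
    obtain ⟨j, hRj, hjK, hj⟩ := hB x₀ hx
    refine (pow_le_pow_left₀ ht hj.le 2).trans ?_
    exact Finset.single_le_sum (f := fun j => l1Dist (nbSeq q X.adjOp j) x₀ ^ 2)
      (fun j _ => sq_nonneg _)
      (Finset.mem_filter.2 ⟨Finset.mem_range.2 (Nat.lt_succ_of_le hjK), hRj⟩)
  have h2 : ∀ j ∈ J, ∑ x₀ ∈ B, l1Dist (nbSeq q X.adjOp j) x₀ ^ 2 ≤ Fintype.card V * E := by
    intro j hj
    obtain ⟨hjK, hRj⟩ := Finset.mem_filter.1 hj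
    calc ∑ x₀ ∈ B, l1Dist (nbSeq q X.adjOp j) x₀ ^ 2
        ≤ ∑ x₀, l1Dist (nbSeq q X.adjOp j) x₀ ^ 2 :=
          Finset.sum_le_univ_sum_of_nonneg fun _ => sq_nonneg _
      _ ≤ ∑ x₀, (Fintype.card V : ℝ) *
            ∑ x, (nbSeq q X.adjOp j x x₀ - 1 / (Fintype.card V : ℝ)) ^ 2 := by
          refine Finset.sum_le_sum fun x₀ _ => ?_
          refine (sq_sum_le_card_mul_sum_sq).trans (le_of_eq ?_)
          simp only [sq_abs, Finset.card_univ]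
      _ ≤ _ := by
          rw [← Finset.mul_sum]
          exact mul_le_mul_of_nonneg_left
            (hE j hRj (Nat.lt_succ_iff.1 (Finset.mem_range.1 hjK))) (Nat.cast_nonneg _)
  have h3 : (J.card : ℝ) ≤ K + 1 := by
    have := Finset.card_filter_le (Finset.range (K + 1)) fun j : ℕ => R < j
    rw [Finset.card_range] at this
    exact_mod_cast this
  rw [Finset.sum_comm] at h1
  refine h1.trans ((Finset.sum_le_card_nsmul _ _ _ h2).trans ?_)
  rw [nsmul_eq_mul]
  exact mul_le_mul_of_nonneg_right h3 (by positivity)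

/-- If all non-backtracking walks of lengths between `(1 + ε / 2) log_q n` and `K` are close to
uniform, then so is the simple random walk from time `K` on. -/
theorem distToUniform_le_of_l1Dist_nbSeq_le {V : Type u} [Fintype V] [DecidableEq V] [Nonempty V]
    {q : ℕ} (hq : q ≠ 0) (X : RegularMultigraph V q) (x₀ : V) {s R t : ℝ} {K k : ℕ}
    (ht : 0 ≤ t) (hs : 1 ≤ s) (h : ∀ j : ℕ, R < j → j ≤ K → l1Dist (nbSeq q X.adjOp j) x₀ ≤ t)
    (hk : K ≤ k) :
    X.distToUniform k x₀ ≤ t + 2 * (s ^ R * (((q : ℝ) / s + s) / (q + 1)) ^ K) := by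
  have hmono : X.distToUniform k x₀ ≤ X.distToUniform K x₀ := X.distToUniform_antitone x₀ hk
  refine hmono.trans ?_
  have := X.l1Dist_adjOp_pow_mul_nbSeq_le hq x₀ ht hs h K 0 (by omega)
  simp only [nbSeq, mul_one, pow_zero] at this
  rw [X.distToUniform_eq_l1Dist]
  linarith

/-- Cutoff from above for all starting points outside a small set, in an expander family with the
density property. -/
theorem exists_bad_forall_distToUniform_le {q : ℕ} (hq : 2 ≤ q) {ι : Type v} {V : ι → Type u}
    [∀ i, Fintype (V i)] [∀ i, DecidableEq (V i)] (X : ∀ i, RegularMultigraph (V i) q)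
    (hX : ∀ i, (X i).IsConnected) (hexp : IsExpanderFamily X) (hSX : SarnakXueDensity X)
    {ε : ℝ} (hε : 0 < ε) :
    ∃ bad : ∀ i, Finset (V i),
      (∀ c : ℝ, 0 < c → ∃ N : ℕ, ∀ i, ¬ (X i).IsBipartite → N ≤ Fintype.card (V i) →
        ((bad i).card : ℝ) ≤ c * (Fintype.card (V i) : ℝ)) ∧
      (∀ c : ℝ, 0 < c → ∃ N : ℕ, ∀ i, ¬ (X i).IsBipartite → N ≤ Fintype.card (V i) →
        ∀ x₀, x₀ ∉ bad i → ∀ k : ℕ,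
          (1 + ε) * (((q : ℝ) + 1) / ((q : ℝ) - 1)) *
            Real.logb (q : ℝ) (Fintype.card (V i) : ℝ) < (k : ℝ) →
          (X i).distToUniform k x₀ ≤ c) := by
  classical
  have hq0 : q ≠ 0 := by omega
  have hq2 : (2 : ℝ) ≤ q := by exact_mod_cast hq
  obtain ⟨η, hη, C, hC0, hC⟩ := exists_sum_nbSeq_sq_le hq X hX hexp hSX hε
  obtain ⟨s, hs, γ, hγ, hdecay⟩ := exists_rpow_mul_pow_le_exp hq hε
  set D : ℝ := (1 + ε) * (((q : ℝ) + 1) / ((q : ℝ) - 1)) with hD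
  have hD0 : 0 ≤ D := mul_nonneg (by linarith) (div_nonneg (by linarith) (by linarith))
  -- The number of steps to be taken, and the distance from uniform that is tolerated.
  set K : ℕ → ℕ := fun n => ⌊D * Real.logb q n⌋₊ + 1 with hK
  set t : ℕ → ℝ := fun n => (n : ℝ) ^ (-(η / 4)) with ht
  set bad : ∀ i, Finset (V i) := fun i => Finset.univ.filter fun x₀ => ∃ j : ℕ,
    (1 + ε / 2) * Real.logb q (Fintype.card (V i)) < j ∧ j ≤ K (Fintype.card (V i)) ∧
      t (Fintype.card (V i)) < l1Dist (nbSeq q (X i).adjOp j) x₀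
  refine ⟨bad, fun c hc => ?_, fun c hc => ?_⟩
  · have hlim := (tendsto_affine_logb_pow_mul_rpow_neg (q := q) (η := η / 2) (by positivity)
      (3 * D) 4).const_mul C
    rw [mul_zero] at hlim
    obtain ⟨N, hN⟩ := eventually_atTop.1 (hlim.eventually_lt_const hc)
    refine ⟨N, fun i hb hi => ?_⟩
    have : Nonempty (V i) := (hX i).nonempty
    set n := Fintype.card (V i) with hn
    have hn1 : (1 : ℝ) ≤ n := by exact_mod_cast Fintype.card_pos
    have hn0 : (0 : ℝ) < n := by linarith
    have hL : 0 ≤ Real.logb q n := Real.logb_nonneg (by linarith) hn1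
    have hKle : (3 * K n + 1 : ℝ) ≤ 3 * D * Real.logb q n + 4 := by
      have := Nat.floor_le (mul_nonneg hD0 hL)
      simp only [hK]; push_cast; linarith
    have hE := (X i).card_mul_sq_le (K := K n) (R := (1 + ε / 2) * Real.logb q n) (t := t n)
      (E := C * (3 * K n + 1) ^ 2 * (n : ℝ) ^ (-η)) (Real.rpow_nonneg hn0.le _) (by positivity)
      (fun j hRj hjK => ?_) (bad i) (fun x₀ hx => (Finset.mem_filter.1 hx).2)
    · have et : t n ^ 2 = (n : ℝ) ^ (-(η / 2)) := by
        simp only [ht]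
        rw [← Real.rpow_natCast, ← Real.rpow_mul hn0.le]
        congr 1; push_cast; ring
      have eη : (n : ℝ) ^ (-η) = (n : ℝ) ^ (-(η / 2)) * (n : ℝ) ^ (-(η / 2)) := by
        rw [← Real.rpow_add hn0]; congr 1; ring
      have hp : 0 < (n : ℝ) ^ (-(η / 2)) := Real.rpow_pos_of_pos hn0 _
      rw [et, eη] at hE
      have hB : ((bad i).card : ℝ) ≤ n * (C * ((K n + 1) * (3 * K n + 1) ^ 2 * (n : ℝ) ^ (-(η / 2)))) := by
        refine le_of_mul_le_mul_right ?_ hp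
        refine hE.trans (le_of_eq ?_)
        rw [← hn]; ring
      refine hB.trans ?_
      rw [mul_comm c]
      refine mul_le_mul_of_nonneg_left (le_trans ?_ (hN n hi).le) hn0.le
      refine mul_le_mul_of_nonneg_left (mul_le_mul_of_nonneg_right ?_ hp.le) hC0
      have hk0 : (0 : ℝ) ≤ K n := Nat.cast_nonneg _
      calc ((K n : ℝ) + 1) * (3 * K n + 1) ^ 2 ≤ (3 * K n + 1) * (3 * K n + 1) ^ 2 := by
            gcongr; linarith
        _ = (3 * K n + 1 : ℝ) ^ 3 := by ring
        _ ≤ _ := pow_le_pow_left₀ (by positivity) hKle 3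
    · refine ((hX i).sum_sum_nbSeq_sub_sq_le hq0 hb j).trans ((hC i j hRj).trans ?_)
      have : (j : ℝ) ≤ K n := by exact_mod_cast hjK
      gcongr
  · have hlim := (tendsto_natCast_rpow_neg (η := η / 4) (by positivity)).add
      ((tendsto_exp_neg_mul_logb hq hγ).const_mul 2)
    rw [mul_zero, add_zero] at hlim
    obtain ⟨N, hN⟩ := eventually_atTop.1 (hlim.eventually_lt_const hc)
    refine ⟨N, fun i _ hi x₀ hx k hk => ?_⟩
    have : Nonempty (V i) := (hX i).nonempty
    set n := Fintype.card (V i) with hn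
    have hn1 : (1 : ℝ) ≤ n := by exact_mod_cast Fintype.card_pos
    have hL : 0 ≤ Real.logb q n := Real.logb_nonneg (by linarith) hn1
    have hKk : K n ≤ k := Nat.succ_le_of_lt ((Nat.floor_lt (mul_nonneg hD0 hL)).2 hk)
    refine ((X i).distToUniform_le_of_l1Dist_nbSeq_le hq0 x₀ (t := t n)
      (Real.rpow_nonneg (by linarith) _) hs (R := (1 + ε / 2) * Real.logb q n)
      (fun j hRj hjK => ?_) hKk).trans (le_trans ?_ (hN n hi).le)
    · by_contra! hlt
      exact hx (Finset.mem_filter.2 ⟨Finset.mem_univ _, j, hRj, hjK, hlt⟩)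
    · have hKn : D * Real.logb q n ≤ K n := by
        simp only [hK]; push_cast; exact (Nat.lt_floor_add_one _).le
      have := hdecay _ hL _ hKn
      linarith

/-- In a vertex-transitive graph the distance to uniform does not depend on the starting point,
so that one good starting point suffices. -/
theorem forall_distToUniform_le_of_isVertexTransitive {V : Type u} [Fintype V] [DecidableEq V]
    {q : ℕ} {X : RegularMultigraph V q} (hX : X.IsVertexTransitive) {bad : Finset V}
    (hbad : bad.card < Fintype.card V) {k : ℕ} {c : ℝ}
    (h : ∀ x₀, x₀ ∉ bad → X.distToUniform k x₀ ≤ c) (x₀ : V) : X.distToUniform k x₀ ≤ c := by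
  obtain ⟨y, hy⟩ : ∃ y, y ∉ bad := by
    by_contra! hall
    rw [Finset.eq_univ_iff_forall.2 hall, Finset.card_univ] at hbad
    exact lt_irrefl _ hbad
  rw [hX.distToUniform_eq k x₀ y]
  exact h y hy

end RegularMultigraph

/-! ### The lower bound -/

namespace RegularMultigraph

variable {V : Type u} [Fintype V] {q : ℕ}

/-- The graph distance to the vertex `x₀`. -/
noncomputable def distTo (X : RegularMultigraph V q) (x₀ x : V) : ℕ :=
  X.toSimpleGraph.dist x x₀

theorem IsConnected.distTo_le_succ {X : RegularMultigraph V q} (hX : X.IsConnected) (x₀ : V)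
    {x y : V} (h : X.mult x y ≠ 0) : X.distTo x₀ y ≤ X.distTo x₀ x + 1 := by
  by_cases hxy : x = y
  · rw [hxy]; exact Nat.le_succ _
  · have hadj : X.toSimpleGraph.Adj y x := ⟨fun h => hxy h.symm, by rw [X.mult_symm]; exact h⟩
    have h1 : X.toSimpleGraph.dist y x = 1 := SimpleGraph.dist_eq_one_iff_adj.2 hadj
    have h2 := SimpleGraph.Connected.dist_triangle hX (u := y) (v := x) (w := x₀)
    unfold distTo
    omega

theorem IsConnected.exists_distTo_add_one_eq {X : RegularMultigraph V q} (hX : X.IsConnected)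
    {x₀ x : V} (hx : X.distTo x₀ x ≠ 0) :
    ∃ y, X.mult x y ≠ 0 ∧ X.distTo x₀ y + 1 = X.distTo x₀ x := by
  obtain ⟨w, hw⟩ := SimpleGraph.Connected.exists_walk_length_eq_dist hX x x₀
  cases w with
  | nil => exact absurd SimpleGraph.dist_self hx
  | @cons _ y _ hadj p =>
    refine ⟨y, hadj.2, ?_⟩
    have h1 := SimpleGraph.dist_le p
    have h2 := hX.distTo_le_succ x₀ (x := y) (y := x) (by rw [X.mult_symm]; exact hadj.2)
    rw [SimpleGraph.Walk.length_cons] at hw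
    unfold distTo at *
    omega

theorem IsConnected.card_sphere_succ_le {X : RegularMultigraph V q} (hX : X.IsConnected)
    (x₀ : V) (j : ℕ) (hj : j ≠ 0) :
    (Finset.univ.filter fun x => X.distTo x₀ x = j + 1).card ≤
      q * (Finset.univ.filter fun x => X.distTo x₀ x = j).card := by
  classical
  set S := Finset.univ.filter fun x => X.distTo x₀ x = j
  set S' := Finset.univ.filter fun x => X.distTo x₀ x = j + 1
  calc S'.card = ∑ y ∈ S', 1 := by simp
    _ ≤ ∑ y ∈ S', ∑ x ∈ S, X.mult x y := by
        refine Finset.sum_le_sum fun y hy => ?_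
        have hy' := (Finset.mem_filter.1 hy).2
        obtain ⟨x, hx, hxd⟩ := hX.exists_distTo_add_one_eq (x₀ := x₀) (x := y) (by omega)
        rw [X.mult_symm] at hx
        exact (Nat.one_le_iff_ne_zero.2 hx).trans (Finset.single_le_sum
          (f := fun x => X.mult x y) (fun _ _ => Nat.zero_le _)
          (Finset.mem_filter.2 ⟨Finset.mem_univ _, by omega⟩))
    _ = ∑ x ∈ S, ∑ y ∈ S', X.mult x y := Finset.sum_comm
    _ ≤ ∑ x ∈ S, q := by
        refine Finset.sum_le_sum fun x hx => ?_
        have hx' := (Finset.mem_filter.1 hx).2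
        -- One of the `q + 1` edges at `x` leads back towards `x₀`.
        obtain ⟨z, hz, hzd⟩ := hX.exists_distTo_add_one_eq (x₀ := x₀) (x := x) (by omega)
        have hzS : z ∉ S' := fun h => by
          have := (Finset.mem_filter.1 h).2
          omega
        have h1 := Finset.sum_le_sum_of_subset (f := fun y => X.mult x y)
          (Finset.subset_univ (insert z S'))
        rw [Finset.sum_insert hzS, X.regular] at h1
        have := Nat.one_le_iff_ne_zero.2 hz
        omega
    _ = q * S.card := by rw [Finset.sum_const, smul_eq_mul, mul_comm]

theorem IsConnected.card_sphere_le (hq : 2 ≤ q) {X : RegularMultigraph V q} (hX : X.IsConnected)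
    (x₀ : V) (j : ℕ) : (Finset.univ.filter fun x => X.distTo x₀ x = j).card ≤ 2 * q ^ j := by
  classical
  have h0 : ∀ x, X.distTo x₀ x = 0 → x = x₀ := fun x hx =>
    (SimpleGraph.Connected.dist_eq_zero_iff hX).1 hx
  rcases j with _ | j
  · refine (Finset.card_le_one.2 fun a ha b hb => ?_).trans (by norm_num)
    rw [h0 a (Finset.mem_filter.1 ha).2, h0 b (Finset.mem_filter.1 hb).2]
  · induction j with
    | zero =>
      calc (Finset.univ.filter fun x => X.distTo x₀ x = 0 + 1).card
          = ∑ y ∈ Finset.univ.filter fun x => X.distTo x₀ x = 0 + 1, 1 := by simp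
        _ ≤ ∑ y ∈ Finset.univ.filter fun x => X.distTo x₀ x = 0 + 1, X.mult x₀ y := by
            refine Finset.sum_le_sum fun y hy => ?_
            have hy' := (Finset.mem_filter.1 hy).2
            obtain ⟨x, hx, hxd⟩ := hX.exists_distTo_add_one_eq (x₀ := x₀) (x := y) (by omega)
            rw [X.mult_symm, h0 x (by omega)] at hx
            exact Nat.one_le_iff_ne_zero.2 hx
        _ ≤ ∑ y, X.mult x₀ y := Finset.sum_le_univ_sum_of_nonneg fun _ => Nat.zero_le _
        _ ≤ 2 * q ^ (0 + 1) := by rw [X.regular]; simp; omega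
    | succ j ih =>
      refine (hX.card_sphere_succ_le x₀ (j + 1) (by omega)).trans ?_
      calc _ ≤ q * (2 * q ^ (j + 1)) := Nat.mul_le_mul_left q ih
        _ = _ := by ring

theorem IsConnected.card_ball_le (hq : 2 ≤ q) {X : RegularMultigraph V q} (hX : X.IsConnected)
    (x₀ : V) (r : ℕ) : (Finset.univ.filter fun x => X.distTo x₀ x ≤ r).card ≤ 4 * q ^ r := by
  classical
  induction r with
  | zero =>
    have := hX.card_sphere_le hq x₀ 0
    simp only [Nat.le_zero]
    simp only [pow_zero] at this ⊢
    omega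
  | succ r ih =>
    have e : (Finset.univ.filter fun x => X.distTo x₀ x ≤ r + 1) =
        (Finset.univ.filter fun x => X.distTo x₀ x ≤ r) ∪
          (Finset.univ.filter fun x => X.distTo x₀ x = r + 1) := by
      ext x
      simp only [Finset.mem_filter, Finset.mem_univ, true_and, Finset.mem_union]
      omega
    rw [e]
    refine (Finset.card_union_le _ _).trans ?_
    have h1 := hX.card_sphere_le hq x₀ (r + 1)
    have h2 : 2 * q ^ r ≤ q ^ (r + 1) := by
      rw [pow_succ, mul_comm]; exact Nat.mul_le_mul_left _ hq
    omega

/-- One step of the walk multiplies `s ^ distance` on average by at most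
`ρ = (q s + 1 / s) / (q + 1)`; the additive term `s` is needed at `x₀` only. -/
theorem IsConnected.sum_adjOp_mul_pow_distTo_le {X : RegularMultigraph V q} (hX : X.IsConnected)
    (x₀ : V) {s : ℝ} (hs : 1 ≤ s) (y : V) :
    ∑ x, s ^ X.distTo x₀ x * X.adjOp x y ≤
      (q * s + 1 / s) / (q + 1) * s ^ X.distTo x₀ y + s := by
  have hs0 : 0 < s := by linarith
  set d := X.distTo x₀ with hd
  have hle : ∀ x, s ^ d x * X.adjOp x y ≤ s ^ (d y + 1) * X.adjOp x y := by
    intro x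
    by_cases hx : X.mult x y = 0
    · simp [adjOp_apply, hx]
    · rw [X.mult_symm] at hx
      exact mul_le_mul_of_nonneg_right (pow_le_pow_right₀ hs (hX.distTo_le_succ x₀ hx))
        (X.adjOp_nonneg _ _)
  have htot : ∑ x, s ^ (d y + 1) * X.adjOp x y = s ^ (d y + 1) := by
    rw [← Finset.mul_sum, sum_adjOp, mul_one]
  by_cases hy : d y = 0
  · refine (Finset.sum_le_sum fun x _ => hle x).trans ?_
    rw [htot, hy]
    have : 0 ≤ ((q : ℝ) * s + 1 / s) / (q + 1) * s ^ 0 := by positivity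
    simpa using this
  · obtain ⟨z, hz, (hzd : d z + 1 = d y)⟩ := hX.exists_distTo_add_one_eq (x₀ := x₀) hy
    have h1 : (s ^ (d y + 1) - s ^ d z) * (1 / ((q : ℝ) + 1)) ≤
        ∑ x, (s ^ (d y + 1) * X.adjOp x y - s ^ d x * X.adjOp x y) := by
      refine le_trans ?_ (Finset.single_le_sum
        (f := fun x => s ^ (d y + 1) * X.adjOp x y - s ^ d x * X.adjOp x y)
        (fun x _ => sub_nonneg.2 (hle x)) (Finset.mem_univ z))
      rw [← sub_mul]
      refine mul_le_mul_of_nonneg_left ?_ (sub_nonneg.2 (pow_le_pow_right₀ hs (by omega)))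
      rw [adjOp_apply, X.mult_symm]
      have : (1 : ℝ) ≤ X.mult y z := by exact_mod_cast Nat.one_le_iff_ne_zero.2 hz
      gcongr
    rw [Finset.sum_sub_distrib, htot] at h1
    have hdy : d y = d z + 1 := hzd.symm
    have e : s ^ (d y + 1) - (s ^ (d y + 1) - s ^ d z) * (1 / ((q : ℝ) + 1)) =
        (q * s + 1 / s) / (q + 1) * s ^ d y := by
      rw [hdy, pow_succ, pow_succ]
      field_simp
      ring
    linarith

variable [DecidableEq V]

/-- Exponential moments of the distance from the starting point. The additive term comes from the
returns to the starting point. -/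
theorem IsConnected.sum_pow_distTo_mul_adjOp_pow_le {X : RegularMultigraph V q}
    (hX : X.IsConnected) (x₀ : V) {s ρ : ℝ} (hs : 1 ≤ s) (hρ : ρ = (q * s + 1 / s) / (q + 1))
    (hρ1 : 1 < ρ) (k : ℕ) :
    ∑ x, s ^ X.distTo x₀ x * (X.adjOp ^ k) x x₀ ≤ ρ ^ k * (1 + s / (ρ - 1)) := by
  have hs0 : 0 < s := by linarith
  have hρ0 : 0 < ρ - 1 := by linarith
  suffices h : ∑ x, s ^ X.distTo x₀ x * (X.adjOp ^ k) x x₀ + s / (ρ - 1) ≤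
      ρ ^ k * (1 + s / (ρ - 1)) by
    have : 0 ≤ s / (ρ - 1) := by positivity
    linarith
  induction k with
  | zero =>
    have : X.distTo x₀ x₀ = 0 := SimpleGraph.dist_self
    simp [Matrix.one_apply, this]
  | succ k ih =>
    have hstep : ∑ x, s ^ X.distTo x₀ x * (X.adjOp ^ (k + 1)) x x₀ ≤
        ρ * ∑ x, s ^ X.distTo x₀ x * (X.adjOp ^ k) x x₀ + s := by
      calc ∑ x, s ^ X.distTo x₀ x * (X.adjOp ^ (k + 1)) x x₀
          = ∑ y, (∑ x, s ^ X.distTo x₀ x * X.adjOp x y) * (X.adjOp ^ k) y x₀ := by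
            simp_rw [pow_succ' X.adjOp, Matrix.mul_apply, Finset.mul_sum, Finset.sum_mul,
              mul_assoc]
            exact Finset.sum_comm
        _ ≤ ∑ y, (ρ * s ^ X.distTo x₀ y + s) * (X.adjOp ^ k) y x₀ := by
            refine Finset.sum_le_sum fun y _ => ?_
            rw [hρ]
            exact mul_le_mul_of_nonneg_right (hX.sum_adjOp_mul_pow_distTo_le x₀ hs y)
              (X.adjOp_pow_nonneg k y x₀)
        _ = _ := by
            simp_rw [add_mul, Finset.sum_add_distrib, ← Finset.mul_sum, sum_adjOp_pow, mul_one,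
              mul_assoc, ← Finset.mul_sum]
    have e : s + s / (ρ - 1) = ρ * (s / (ρ - 1)) := by field_simp; ring
    calc _ ≤ ρ * (∑ x, s ^ X.distTo x₀ x * (X.adjOp ^ k) x x₀ + s / (ρ - 1)) := by linarith
      _ ≤ ρ * (ρ ^ k * (1 + s / (ρ - 1))) := mul_le_mul_of_nonneg_left ih (by linarith)
      _ = _ := by ring

/-- The mass outside the ball of radius `R`, by Markov's inequality. -/
theorem IsConnected.sum_compl_ball_adjOp_pow_le {X : RegularMultigraph V q}
    (hX : X.IsConnected) (x₀ : V) {s ρ R : ℝ} (hs : 1 ≤ s)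
    (hρ : ρ = (q * s + 1 / s) / (q + 1)) (hρ1 : 1 < ρ) (k : ℕ) :
    ∑ x ∈ (Finset.univ.filter fun x => X.distTo x₀ x ≤ ⌊R⌋₊)ᶜ, (X.adjOp ^ k) x x₀ ≤
      (1 + s / (ρ - 1)) * (ρ ^ k * s ^ (-R)) := by
  have hs0 : 0 < s := by linarith
  calc ∑ x ∈ (Finset.univ.filter fun x => X.distTo x₀ x ≤ ⌊R⌋₊)ᶜ, (X.adjOp ^ k) x x₀
      ≤ ∑ x ∈ (Finset.univ.filter fun x => X.distTo x₀ x ≤ ⌊R⌋₊)ᶜ,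
          s ^ (-R) * (s ^ X.distTo x₀ x * (X.adjOp ^ k) x x₀) := by
        refine Finset.sum_le_sum fun x hx => ?_
        have hx' : ⌊R⌋₊ < X.distTo x₀ x := by simpa using hx
        rw [← mul_assoc]
        refine le_mul_of_one_le_left (X.adjOp_pow_nonneg k x x₀) ?_
        rw [← Real.rpow_natCast, ← Real.rpow_add hs0]
        refine Real.one_le_rpow hs ?_
        have := Nat.lt_of_floor_lt hx'
        linarith
    _ ≤ ∑ x, s ^ (-R) * (s ^ X.distTo x₀ x * (X.adjOp ^ k) x x₀) := by
        refine Finset.sum_le_univ_sum_of_nonneg fun x => ?_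
        have := X.adjOp_pow_nonneg k x x₀
        positivity
    _ ≤ s ^ (-R) * (ρ ^ k * (1 + s / (ρ - 1))) := by
        rw [← Finset.mul_sum]
        exact mul_le_mul_of_nonneg_left (hX.sum_pow_distTo_mul_adjOp_pow_le x₀ hs hρ hρ1 k)
          (by positivity)
    _ = _ := by ring

end RegularMultigraph

/-- A large deviation bound: a walk on `ℕ` with steps `1` and `-1` of probabilities `q / (q + 1)`
and `1 / (q + 1)` is unlikely to be above `(1 - ε / 2) L` at a time
`k ≤ (1 - ε) L (q + 1) / (q - 1)`. -/
theorem exists_pow_mul_rpow_neg_le_exp {q : ℕ} (hq : 2 ≤ q) {ε : ℝ} (hε : 0 < ε) (hε1 : ε < 1) :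
    ∃ s : ℝ, 1 ≤ s ∧ ∃ ρ : ℝ, ρ = (q * s + 1 / s) / (q + 1) ∧ 1 < ρ ∧ ∃ γ : ℝ, 0 < γ ∧
      ∀ L : ℝ, 0 ≤ L → ∀ k : ℕ, k ≤ (1 - ε) * (((q : ℝ) + 1) / ((q : ℝ) - 1)) * L →
        ρ ^ k * s ^ (-((1 - ε / 2) * L)) ≤ Real.exp (-(γ * L)) := by
  have hq2 : (2 : ℝ) ≤ q := by exact_mod_cast hq
  have hq1 : (0 : ℝ) < q - 1 := by linarith
  set t := ε / 8 with ht
  have ht0 : 0 < t := by positivity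
  have hs0 : 0 < 1 + t := by linarith
  set β := t * (q * (1 + t) - 1) / ((1 + t) * (q + 1)) with hβ
  have hβ0 : 0 < β := div_pos (mul_pos ht0 (by nlinarith)) (by positivity)
  set κ := ((q : ℝ) + 1) / ((q : ℝ) - 1) with hκ
  have hρ : ((q : ℝ) * (1 + t) + 1 / (1 + t)) / (q + 1) = 1 + β := by
    rw [hβ]; field_simp; ring
  refine ⟨1 + t, by linarith, _, rfl, by linarith,
    (1 - ε / 2) * (t / (1 + t)) - β * ((1 - ε) * κ), ?_, fun L hL k hk => ?_⟩
  · have e : β * ((1 - ε) * κ) = t / (1 + t) * ((1 - ε) * ((q * (1 + t) - 1) / (q - 1))) := by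
      rw [hβ, hκ]; field_simp
    have h1 : (q * (1 + t) - 1) / (q - 1) ≤ 1 + 2 * t := by
      rw [div_le_iff₀ hq1]
      nlinarith
    have h2 : (1 - ε) * ((q * (1 + t) - 1) / (q - 1)) ≤ (1 - ε) * (1 + 2 * t) :=
      mul_le_mul_of_nonneg_left h1 (by linarith)
    have h3 : (1 - ε) * (1 + 2 * t) < 1 - ε / 2 := by rw [ht]; nlinarith
    rw [e, mul_comm (1 - ε / 2), ← mul_sub]
    exact mul_pos (by positivity) (by linarith)
  · rw [hρ]
    have h1 : (1 + β) ^ k ≤ Real.exp (β * ((1 - ε) * κ * L)) := by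
      calc _ ≤ Real.exp β ^ k := by
            refine pow_le_pow_left₀ (by linarith) ?_ k
            have := Real.add_one_le_exp β
            linarith
        _ = Real.exp (β * k) := by rw [← Real.exp_nat_mul]; congr 1; ring
        _ ≤ _ := Real.exp_le_exp.2 (mul_le_mul_of_nonneg_left hk hβ0.le)
    have h2 : (1 + t) ^ (-((1 - ε / 2) * L)) ≤ Real.exp (t / (1 + t) * (-((1 - ε / 2) * L))) := by
      rw [Real.rpow_def_of_pos hs0]
      have h3 : t / (1 + t) ≤ Real.log (1 + t) := by
        have := Real.one_sub_inv_le_log_of_pos hs0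
        have e : t / (1 + t) = 1 - (1 + t)⁻¹ := by field_simp; ring
        linarith
      have h4 : 0 ≤ (1 - ε / 2) * L := mul_nonneg (by linarith) hL
      exact Real.exp_le_exp.2 (mul_le_mul_of_nonpos_right h3 (by linarith))
    refine (mul_le_mul h1 h2 (Real.rpow_nonneg hs0.le _) (Real.exp_pos _).le).trans
      (le_of_eq ?_)
    rw [← Real.exp_add]
    congr 1
    ring

namespace RegularMultigraph

/-- Before the time `(1 - ε) (q + 1) / (q - 1) log_q n` the walk is concentrated on a ball of
radius `(1 - ε / 2) log_q n`, which holds a negligible proportion of the vertices. -/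
theorem exists_forall_abs_two_sub_distToUniform_le {q : ℕ} (hq : 2 ≤ q) {ε : ℝ} (hε : 0 < ε)
    {c : ℝ} (hc : 0 < c) :
    ∃ N : ℕ, ∀ (V : Type u) [Fintype V] [DecidableEq V] (X : RegularMultigraph V q),
      X.IsConnected → N ≤ Fintype.card V → ∀ (x₀ : V) (k : ℕ),
        (k : ℝ) < (1 - ε) * (((q : ℝ) + 1) / ((q : ℝ) - 1)) *
          Real.logb (q : ℝ) (Fintype.card V : ℝ) →
        |2 - X.distToUniform k x₀| ≤ c := by
  have hq2 : (2 : ℝ) ≤ q := by exact_mod_cast hq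
  have hlogb : ∀ (V : Type u) [Fintype V] [Nonempty V], 0 ≤ Real.logb q (Fintype.card V) :=
    fun V _ _ => Real.logb_nonneg (by linarith) (by exact_mod_cast Fintype.card_pos)
  rcases le_or_gt 1 ε with hε1 | hε1
  · refine ⟨0, fun V _ _ X hX _ x₀ k hk => absurd hk (not_lt.2 ?_)⟩
    have : Nonempty V := hX.nonempty
    refine le_trans (mul_nonpos_of_nonpos_of_nonneg ?_ (hlogb V)) (Nat.cast_nonneg k)
    exact mul_nonpos_of_nonpos_of_nonneg (by linarith)
      (div_nonneg (by linarith) (by linarith))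
  obtain ⟨s, hs, ρ, hρ, hρ1, γ, hγ, hdecay⟩ := exists_pow_mul_rpow_neg_le_exp hq hε hε1
  set C := 1 + s / (ρ - 1) with hC
  have hC0 : 0 ≤ C := by
    have : 0 ≤ s / (ρ - 1) := div_nonneg (by linarith) (by linarith)
    linarith
  have hlim := ((tendsto_exp_neg_mul_logb hq hγ).const_mul (2 * C)).add
    ((tendsto_natCast_rpow_neg (η := ε / 2) (by positivity)).const_mul 8)
  rw [mul_zero, mul_zero, add_zero] at hlim
  obtain ⟨N, hN⟩ := eventually_atTop.1 (hlim.eventually_lt_const hc)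
  refine ⟨N, fun V _ _ X hX hNV x₀ k hk => ?_⟩
  have : Nonempty V := hX.nonempty
  set n := Fintype.card V with hn
  have hL : 0 ≤ Real.logb q n := hlogb V
  have hn0 : (0 : ℝ) < n := by exact_mod_cast Fintype.card_pos
  set R := (1 - ε / 2) * Real.logb q n with hR
  have hR0 : 0 ≤ R := mul_nonneg (by linarith) hL
  set B := Finset.univ.filter fun x => X.distTo x₀ x ≤ ⌊R⌋₊ with hB
  have hlow := le_l1Dist (X.sum_adjOp_pow k x₀) B
    (hX.sum_compl_ball_adjOp_pow_le x₀ hs hρ hρ1 k (R := R))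
  have hup := l1Dist_le_two (fun x => X.adjOp_pow_nonneg k x x₀) (X.sum_adjOp_pow k x₀)
  rw [← distToUniform_eq_l1Dist] at hlow hup
  have hcard : (B.card : ℝ) / n ≤ 4 * (n : ℝ) ^ (-(ε / 2)) := by
    rw [div_le_iff₀ hn0]
    calc (B.card : ℝ) ≤ 4 * (q : ℝ) ^ ⌊R⌋₊ := by exact_mod_cast hX.card_ball_le hq x₀ ⌊R⌋₊
      _ ≤ 4 * (q : ℝ) ^ R := by
          rw [← Real.rpow_natCast]
          gcongr
          · linarith
          · exact Nat.floor_le hR0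
      _ = 4 * (n : ℝ) ^ (-(ε / 2)) * n := by
          rw [hR, mul_comm (1 - ε / 2), Real.rpow_mul (by linarith),
            Real.rpow_logb (by linarith) (by linarith) hn0, mul_assoc]
          congr 1
          nth_rewrite 3 [← Real.rpow_one (n : ℝ)]
          rw [← Real.rpow_add hn0]
          congr 1
          ring
  have hd := mul_le_mul_of_nonneg_left (hdecay _ hL k hk.le) hC0
  have hNn := hN n hNV
  rw [abs_of_nonneg (by linarith)]
  linarith

end RegularMultigraph

/-! ### Cutoff -/

theorem mainTheorem3 (q : ℕ) (hq : 2 ≤ q) :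
    (∀ ε : ℝ, 0 < ε → ∀ c : ℝ, 0 < c → ∃ N : ℕ,
      ∀ (V : Type u) [Fintype V] [DecidableEq V] (X : RegularMultigraph V q),
        X.IsConnected → ¬ X.IsBipartite → N ≤ Fintype.card V →
        ∀ (x₀ : V) (k : ℕ),
          (k : ℝ) < (1 - ε) * (((q : ℝ) + 1) / ((q : ℝ) - 1)) *
            Real.logb (q : ℝ) (Fintype.card V : ℝ) →
          |2 - X.distToUniform k x₀| ≤ c) ∧
    (∀ (ι : Type v) (V : ι → Type u) [∀ i, Fintype (V i)] [∀ i, DecidableEq (V i)]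
      (X : ∀ i, RegularMultigraph (V i) q),
      (∀ i, (X i).IsConnected) → IsExpanderFamily X → SarnakXueDensity X →
      ∀ ε : ℝ, 0 < ε →
        (∃ bad : ∀ i, Finset (V i),
          (∀ c : ℝ, 0 < c → ∃ N : ℕ, ∀ i, ¬ (X i).IsBipartite → N ≤ Fintype.card (V i) →
            ((bad i).card : ℝ) ≤ c * (Fintype.card (V i) : ℝ)) ∧
          (∀ c : ℝ, 0 < c → ∃ N : ℕ, ∀ i, ¬ (X i).IsBipartite → N ≤ Fintype.card (V i) →
            ∀ x₀, x₀ ∉ bad i → ∀ k : ℕ,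
              (1 + ε) * (((q : ℝ) + 1) / ((q : ℝ) - 1)) *
                Real.logb (q : ℝ) (Fintype.card (V i) : ℝ) < (k : ℝ) →
              (X i).distToUniform k x₀ ≤ c)) ∧
        (∀ c : ℝ, 0 < c → ∃ N : ℕ, ∀ i, ¬ (X i).IsBipartite → (X i).IsVertexTransitive →
          N ≤ Fintype.card (V i) →
            ∀ (x₀ : V i) (k : ℕ),
              (1 + ε) * (((q : ℝ) + 1) / ((q : ℝ) - 1)) *
                Real.logb (q : ℝ) (Fintype.card (V i) : ℝ) < (k : ℝ) →
              (X i).distToUniform k x₀ ≤ c)) := by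
  refine ⟨fun ε hε c hc => ?_, fun ι V _ _ X hX hexp hSX ε hε => ?_⟩
  · obtain ⟨N, hN⟩ :=
      RegularMultigraph.exists_forall_abs_two_sub_distToUniform_le.{u} hq hε hc
    exact ⟨N, fun V _ _ X hX _ hn x₀ k hk => hN V X hX hn x₀ k hk⟩
  · obtain ⟨bad, hbad, hmix⟩ :=
      RegularMultigraph.exists_bad_forall_distToUniform_le hq X hX hexp hSX hε
    refine ⟨⟨bad, hbad, hmix⟩, fun c hc => ?_⟩
    obtain ⟨N₁, h₁⟩ := hbad (1 / 2) (by norm_num)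
    obtain ⟨N₂, h₂⟩ := hmix c hc
    refine ⟨max N₁ N₂, fun i hb ht hn x₀ k hk => ?_⟩
    refine RegularMultigraph.forall_distToUniform_le_of_isVertexTransitive ht (bad := bad i) ?_
      (fun y hy => h₂ i hb (le_of_max_le_right hn) y hy k hk) x₀
    have hcard := h₁ i hb (le_of_max_le_left hn)
    have : Nonempty (V i) := (hX i).nonempty
    have hpos : (0 : ℝ) < Fintype.card (V i) := by exact_mod_cast Fintype.card_pos
    exact_mod_cast (by linarith : ((bad i).card : ℝ) < Fintype.card (V i))
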